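/- Let $n\ge 3$ and $k\ge 1$ be integers. For $i\ge 0$ let $P_i^{(n)}$ be the Gegenbauer polynomials, orthogonal with respect to the probability measure $d\mu_n(t)=c_n(1-t^2)^{(n-3)/2}\,dt$ on $[-1,1]$ and normalized by $P_i^{(n)}(1)=1$. Let $T^k=\{1,2,\dots,2k+2\}\setminus\{2k\}$. A spherical $T^k$-design is a nonempty finite set $C\subset\mathbb{S}^{n-1}$ with $\sum_{x,y\in C}P_i^{(n)}(x\cdot y)=0$ for all $i\in T^k$. With $\alpha=n/2-1$, let $b>0>c$ be the two solutions of $$bc=-\frac{(k+1)k(\alpha+k-1)}{(2\alpha+k)(2\alpha+k-1)(\alpha+k+1)},\qquad b+c=-\frac{2\alpha(k+1)^2(\alpha+k-1)}{(2\alpha+k)(2\alpha+k-1)(\alpha+2k+1)},$$ and put $q_{k+1}=P_{k+1}^{(n)}+b\,P_{k-1}^{(n)}$. Then $q_{k+1}$ has $k+1$ distinct real roots $\beta_1<\dots<\beta_{k+1}$, all in $(-1,1)$, and the weights $\gamma_i=\int_{-1}^1 L_i\,d\mu_n$ ($L_i$ the Lagrange basis polynomials of the nodes $\beta_1,\dots,\beta_{k+1}$)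 are positive and satisfy $\int_{-1}^1 f\,d\mu_n=\sum_{i=1}^{k+1}\gamma_i f(\beta_i)$ for all $f\in\mathrm{span}\{P_i^{(n)}: i\in T^k\cup\{0\}\}$. An absolutely monotone potential is a function $h:[-1,1]\to[0,+\infty]$ that is finite and continuous on $[-1,1)$, has $h^{(i)}\ge 0$ on $(-1,1)$ for all $i\ge 0$, and satisfies $h(t)\le h(1)$ for all $t$. Write $U_h(x,C)=\sum_{y\in C}h(x\cdot y)$ and $\mathcal{Q}_h(C)=\inf_{x\in\mathbb{S}^{n-1}}U_h(x,C)$. Let $C\subset\mathbb{S}^{n-1}$ be a spherical $T^k$-design of cardinality $N$. Then for every absolutely monotone potential $h$ $$\mathcal{Q}_h(C)\ \ge\ N\sum_{i=1}^{k+1}\gamma_i h(\beta_i).\qquad(*)$$ If $h$ does not coincide on $[-1,1)$ with a polynomial of degree at most $2k-1$, then equality holds in $(*)$ if and only if there is a point $\widetilde{x}\in\mathbb{S}^{n-1}$ such that the set of inner products $\{\widetilde{x}\cdot y:y\in C\}$ equals $\{\beta_1,\dots,\beta_{k+1}\}$ and, for each $i$, exactly $N\gamma_i$ points $y\in C$ have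 $\widetilde{x}\cdot y=\beta_i$. The location of such a point does not depend on $h$: every such $\widetilde{x}$ satisfies $U_h(\widetilde{x},C)=\mathcal{Q}_h(C)=N\sum_{i=1}^{k+1}\gamma_i h(\beta_i)$ for every absolutely monotone potential $h$ (polynomial or not), and whenever equality holds in $(*)$ for a potential $h$ that is not a polynomial of degree at most $2k-1$ on $[-1,1)$, the minimum points of $U_h(\cdot,C)$ on $\mathbb{S}^{n-1}$ are exactly the points with this distribution of inner products. -/

import Mathlib

open Polynomial
open scoped ENNReal

noncomputable section

namespace PULB

/-- The Gegenbauer polynomials `P_i^{(n)}`, i.e. the Jacobi polynomials with parameters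
`α = β = (n - 3) / 2` normalized by `P_i^{(n)}(1) = 1`, through their three-term recurrence
`(n - 2 + j) P_{j+1} = (n - 2 + 2 j) t P_j - j P_{j-1}`, with `P_0 = 1` and `P_1 = t`. -/
def gegenbauer (n : ℕ) : ℕ → ℝ[X]
  | 0 => 1
  | 1 => X
  | (i + 2) =>
      C (((n : ℝ) - 2 + (i + 1))⁻¹) *
        (C ((n : ℝ) - 2 + 2 * (i + 1)) * X * gegenbauer n (i + 1)
          - C ((i : ℝ) + 1) * gegenbauer n i)

/-- The weight `(1 - t²)^{(n-3)/2}`. -/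
def weight (n : ℕ) (t : ℝ) : ℝ := (1 - t ^ 2) ^ (((n : ℝ) - 3) / 2)

/-- The integral `∫ f dμ_n` against the probability measure on `[-1, 1]` with density
proportional to `(1 - t²)^{(n-3)/2}`. -/
def mean (n : ℕ) (f : ℝ → ℝ) : ℝ :=
  (∫ t in (-1 : ℝ)..1, f t * weight n t) / ∫ t in (-1 : ℝ)..1, weight n t

/-- A spherical code: a nonempty finite set of points of the unit sphere of `ℝⁿ`. -/
def IsSphericalCode {n : ℕ} (C : Finset (EuclideanSpace ℝ (Fin n))) : Prop :=
  C.Nonempty ∧ ∀ x ∈ C, ‖x‖ = 1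

/-- The `i`-th moment `M_i^n(C) = ∑_{x, y ∈ C} P_i^{(n)}(x · y)`. -/
def moment {n : ℕ} (i : ℕ) (C : Finset (EuclideanSpace ℝ (Fin n))) : ℝ :=
  ∑ x ∈ C, ∑ y ∈ C, (gegenbauer n i).eval (inner ℝ x y)

/-- A spherical `T`-design: a spherical code whose moments with index in `T` vanish. -/
def IsSphericalDesign {n : ℕ} (T : Set ℕ) (C : Finset (EuclideanSpace ℝ (Fin n))) : Prop :=
  IsSphericalCode C ∧ ∀ i ∈ T, moment i C = 0

/-- The index set `T^k = {1, 2, …, 2k + 2} \ {2k}`. -/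
def indexSet (k : ℕ) : Set ℕ := Set.Icc 1 (2 * k + 2) \ {2 * k}

/-- The space `𝒫_T`, the span of the polynomials `P_i^{(n)}` with `i ∈ T ∪ {0}`. -/
def polySpace (n : ℕ) (T : Set ℕ) : Submodule ℝ ℝ[X] :=
  Submodule.span ℝ (gegenbauer n '' (T ∪ {0}))

/-- The parameter `α = n / 2 - 1`. -/
def alpha (n : ℕ) : ℝ := (n : ℝ) / 2 - 1

/-- The sum of the two solutions `b`, `c` of the quadratic system that determines `q_{k+1}`. -/
def bcSum (n k : ℕ) : ℝ :=
  -(2 * alpha n * (k + 1) ^ 2 * (alpha n + k - 1)) /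
    ((2 * alpha n + k) * (2 * alpha n + k - 1) * (alpha n + 2 * k + 1))

/-- The product of the two solutions `b`, `c` of the quadratic system that determines `q_{k+1}`. -/
def bcProd (n k : ℕ) : ℝ :=
  -((k + 1) * k * (alpha n + k - 1)) /
    ((2 * alpha n + k) * (2 * alpha n + k - 1) * (alpha n + k + 1))

/-- The positive one of the two solutions `b > 0 > c` of `b + c = bcSum n k` and
`b * c = bcProd n k`. -/
def bCoeff (n k : ℕ) : ℝ := (bcSum n k + √(bcSum n k ^ 2 - 4 * bcProd n k)) / 2

/-- The polynomial `q_{k+1} = P_{k+1}^{(n)} + b P_{k-1}^{(n)}` (used for `k ≥ 1`). -/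
def nodePoly (n k : ℕ) : ℝ[X] :=
  gegenbauer n (k + 1) + C (bCoeff n k) * gegenbauer n (k - 1)

/-- The nodes `β_i`: the real roots of `q_{k+1}`. -/
def nodes (n k : ℕ) : Finset ℝ := (nodePoly n k).roots.toFinset

/-- The quadrature weight `γ_i = ∫ L_i dμ_n` of the node `β = β_i`, where `L_i` is the Lagrange
basis polynomial of the nodes that is `1` at `β` and `0` at the others. -/
def nodeWeight (n k : ℕ) (β : ℝ) : ℝ :=
  mean n fun t => (Lagrange.basis (nodes n k) id β).eval t

/-- Absolutely monotone potentials on `[-1, 1]`, with values in `[0, ∞]`: finite and continuous on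
`[-1, 1)`, with nonnegative derivatives of all orders in `(-1, 1)`. At the endpoint `1` only
monotonicity is asked, so the value `h 1` may be infinite; every such function that is continuous
on `[-1, 1]` as a function to `[0, ∞]` is included. Values outside `[-1, 1]` play no role. -/
structure IsAbsMonotonePotential (h : ℝ → ℝ≥0∞) : Prop where
  finite : ∀ t ∈ Set.Ico (-1 : ℝ) 1, h t ≠ ∞
  continuousOn : ContinuousOn h (Set.Ico (-1) 1)
  le_one : ∀ t ∈ Set.Ico (-1 : ℝ) 1, h t ≤ h 1
  absMonotone : AbsolutelyMonotoneOn (fun t => (h t).toReal) (Set.Ioo (-1) 1)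

/-- On `[-1, 1)` the function `h` is a polynomial of degree less than `d`. -/
def IsPolynomialOfDegreeLT (d : ℕ) (h : ℝ → ℝ≥0∞) : Prop :=
  ∃ p : ℝ[X], p.degree < d ∧ ∀ t ∈ Set.Ico (-1 : ℝ) 1, (h t).toReal = p.eval t

/-- The discrete potential `U_h(x, C) = ∑_{y ∈ C} h(x · y)`. -/
def potential {n : ℕ} (h : ℝ → ℝ≥0∞) (C : Finset (EuclideanSpace ℝ (Fin n)))
    (x : EuclideanSpace ℝ (Fin n)) : ℝ≥0∞ :=
  ∑ y ∈ C, h (inner ℝ x y)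

/-- The polarization `𝒬_h(C) = inf_{x ∈ 𝕊^{n-1}} U_h(x, C)`. -/
def polarization {n : ℕ} (h : ℝ → ℝ≥0∞) (C : Finset (EuclideanSpace ℝ (Fin n))) : ℝ≥0∞ :=
  ⨅ x : Metric.sphere (0 : EuclideanSpace ℝ (Fin n)) 1, potential h C x

/-- The bound `N ∑_i γ_i h(β_i)`. -/
def secondLevelBound (n k N : ℕ) (h : ℝ → ℝ≥0∞) : ℝ≥0∞ :=
  N * ∑ β ∈ nodes n k, ENNReal.ofReal (nodeWeight n k β) * h β

/-- The point `x` of the sphere has `I(x, C) = {β_i}`, and the inner product `β_i` occurs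
with frequency `N γ_i`, where `N = |C|`. -/
def HasNodeDistribution {n : ℕ} (k : ℕ) (C : Finset (EuclideanSpace ℝ (Fin n)))
    (x : EuclideanSpace ℝ (Fin n)) : Prop :=
  C.image (fun y => (inner ℝ x y : ℝ)) = nodes n k ∧
    ∀ β ∈ nodes n k,
      ((C.filter fun y => (inner ℝ x y : ℝ) = β).card : ℝ) = C.card * nodeWeight n k β

end PULB

end

noncomputable section

namespace PULB

/-! ### Algebra of the Gegenbauer polynomials -/

/-! Write k = m + 1, q = P_{k+1} + b P_{k-1} and r = P_{k+1} + c P_{k-1}. The equations for b and c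
say exactly two things: b + c makes q r = const · P_{2k+2} + (degree ≤ 2k - 1), and b c makes ∫ q r
dμ = 0.

Quadrature. The functional Λ(f) = ∫ f dμ - δ · [t^{2k}] f, with the right δ > 0, satisfies Λ(q g) =
0 for deg g ≤ k - 1 (`nodeLM_nodePoly_mul`), and an upper bound on b makes it positive definite on
squares of degree ≤ 2k (`nodeLM_sq_pos`). Gauss's argument then gives real simple roots of q and
positive weights, with quadrature equal to Λ up to degree 2k, hence to the mean up to degree 2k - 1.
Since q P_k and q r vanish at the nodes and have mean zero, exactness also holds for P_{2k+1} and
P_{2k+2}.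

Designs. By the reproducing property of zonal harmonics, a vanishing moment forces ∑_y P_i(x · y) =
0 for every x on the sphere. So the defect E_x(f) = ∑_y f(x · y) - N · (quadrature of f) vanishes on
degree ≤ 2k - 1 and on P_{2k+1}, P_{2k+2}; up to degree 2k + 2 it is determined by ε = E_x(t^{2k}).
From q² = q r + (b - c) q P_{k-1}, the sum ∑_y q(x · y)² is a positive multiple of ε
(`defectLM_nodePoly_sq`). Hence ε ≥ 0, and ε = 0 only if all inner products are nodes.

Potentials. By Bernstein's theorem, h is a nonnegative combination of powers (1 + t)^j on [-1, 1).
Newton interpolation of (1 + t)^j, with every node taken twice, gives E_x((1 + t)^j) ≥ κ ε with κ ≥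
0, and κ > 0 for j ≥ 2k (`exists_mul_le_defectLM`). Summing gives the bound. A nonzero coefficient
with j ≥ 2k, present unless h is a polynomial of degree < 2k, forces ε = 0 at equality. -/

lemma mul_mem_degreeLT {f g : ℝ[X]} {a b c : ℕ} (hf : f ∈ degreeLT ℝ a)
    (hg : g ∈ degreeLT ℝ b) (h : a + b ≤ c + 1) : f * g ∈ degreeLT ℝ c := by
  by_cases hf0 : f = 0
  · simp [hf0]
  by_cases hg0 : g = 0
  · simp [hg0]
  rw [mem_degreeLT, ← natDegree_lt_iff_degree_lt (by simp_all)] at *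
  rw [natDegree_mul hf0 hg0]
  omega

lemma C_mul_mem_degreeLT {f : ℝ[X]} {a : ℕ} (r : ℝ) (hf : f ∈ degreeLT ℝ a) :
    C r * f ∈ degreeLT ℝ a := by
  rw [← smul_eq_C_mul]
  exact Submodule.smul_mem _ r hf

lemma mem_degreeLT_mono {f : ℝ[X]} {a b : ℕ} (h : a ≤ b) (hf : f ∈ degreeLT ℝ a) :
    f ∈ degreeLT ℝ b := degreeLT_mono h hf

lemma X_pow_mem_degreeLT {a b : ℕ} (h : a < b) : (X ^ a : ℝ[X]) ∈ degreeLT ℝ b := by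
  rw [mem_degreeLT, degree_X_pow]
  exact_mod_cast h

lemma X_mem_degreeLT : (X : ℝ[X]) ∈ degreeLT ℝ 2 := by
  simpa using X_pow_mem_degreeLT (a := 1) (b := 2) (by omega)

lemma C_mem_degreeLT (r : ℝ) {b : ℕ} (h : 0 < b) : (C r : ℝ[X]) ∈ degreeLT ℝ b := by
  have := C_mul_mem_degreeLT r (X_pow_mem_degreeLT h)
  simpa using this

lemma mem_degreeLT_succ_iff {f : ℝ[X]} {a : ℕ} :
    f ∈ degreeLT ℝ (a + 1) ↔ f.natDegree ≤ a := by
  by_cases h : f = 0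
  · simp [h]
  · rw [mem_degreeLT, ← natDegree_lt_iff_degree_lt h, Nat.lt_succ_iff]

lemma mem_degreeLT_of_C_mul_mem {f : ℝ[X]} {a : ℕ} {r : ℝ} (hr : r ≠ 0)
    (hf : C r * f ∈ degreeLT ℝ a) : f ∈ degreeLT ℝ a := by
  have := C_mul_mem_degreeLT r⁻¹ hf
  rwa [← mul_assoc, ← C_mul, inv_mul_cancel₀ hr, C_1, one_mul] at this

variable {n : ℕ}

lemma cast_ge_three (hn : 3 ≤ n) : (3 : ℝ) ≤ n := by exact_mod_cast hn

lemma gegenbauer_zero (n : ℕ) : gegenbauer n 0 = 1 := by rw [gegenbauer]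

lemma gegenbauer_one (n : ℕ) : gegenbauer n 1 = X := by rw [gegenbauer]

lemma gegenbauer_recurrence (hn : 3 ≤ n) (i : ℕ) :
    C ((n : ℝ) - 1 + i) * gegenbauer n (i + 2) =
      C ((n : ℝ) + 2 * i) * X * gegenbauer n (i + 1) - C ((i : ℝ) + 1) * gegenbauer n i := by
  have h3 := cast_ge_three hn
  have h : (n : ℝ) - 2 + (i + 1) ≠ 0 := by
    have : (0 : ℝ) ≤ i := i.cast_nonneg
    linarith
  have e1 : (n : ℝ) - 1 + i = n - 2 + (i + 1) := by ring
  have e2 : (n : ℝ) + 2 * i = n - 2 + 2 * (i + 1) := by ring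
  rw [gegenbauer, ← mul_assoc, e1, e2, ← C_mul, mul_inv_cancel₀ h, C_1, one_mul]

/-- The leading coefficient of the Gegenbauer polynomial `P_i^{(n)}`. -/
def gegLead (n : ℕ) : ℕ → ℝ
  | 0 => 1
  | i + 1 => gegLead n i * (((n : ℝ) - 2 + 2 * i) / ((n : ℝ) - 2 + i))

lemma gegLead_pos (hn : 3 ≤ n) (i : ℕ) : 0 < gegLead n i := by
  have h3 := cast_ge_three hn
  induction i with
  | zero => simp [gegLead]
  | succ i ih =>
    have : (0 : ℝ) ≤ i := i.cast_nonneg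
    rw [gegLead]
    exact mul_pos ih (div_pos (by linarith) (by linarith))

lemma gegLead_succ (hn : 3 ≤ n) (i : ℕ) :
    ((n : ℝ) - 2 + i) * gegLead n (i + 1) = ((n : ℝ) - 2 + 2 * i) * gegLead n i := by
  have h3 := cast_ge_three hn
  have : (n : ℝ) - 2 + i ≠ 0 := by
    have : (0 : ℝ) ≤ i := i.cast_nonneg
    linarith
  rw [gegLead]
  field_simp

lemma gegLead_one (hn : 3 ≤ n) : gegLead n 1 = 1 := by
  have h3 := cast_ge_three hn
  have := gegLead_succ hn 0
  have h2 : (n : ℝ) - 2 ≠ 0 := by linarith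
  simp only [Nat.cast_zero, mul_zero, add_zero, zero_add] at this
  exact mul_left_cancel₀ h2 (by rw [this, gegLead])

/-- The bound `i - 1` records parity: the coefficient of t^{i-1} vanishes too. For i ≤ 1 the
truncated subtraction says that the remainder is zero. -/
lemma gegenbauer_sub_lead_mem (hn : 3 ≤ n) (i : ℕ) :
    gegenbauer n i - C (gegLead n i) * X ^ i ∈ degreeLT ℝ (i - 1) := by
  have h3 := cast_ge_three hn
  induction i using Nat.twoStepInduction with
  | zero => simp [gegenbauer, gegLead]
  | one => simp [gegenbauer, gegLead_one hn]
  | more i ih0 ih1 =>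
    have hi : (0 : ℝ) ≤ i := i.cast_nonneg
    have hc : (n : ℝ) - 1 + i ≠ 0 := by linarith
    apply mem_degreeLT_of_C_mul_mem hc
    have hl := gegLead_succ hn (i + 1)
    push_cast at hl
    have e : C ((n : ℝ) - 1 + i) * (gegenbauer n (i + 2) - C (gegLead n (i + 2)) * X ^ (i + 2)) =
        C ((n : ℝ) + 2 * i) *
          (X * (gegenbauer n (i + 1) - C (gegLead n (i + 1)) * X ^ (i + 1))) -
        C ((i : ℝ) + 1) * (gegenbauer n i - C (gegLead n i) * X ^ i) -
        C (((i : ℝ) + 1) * gegLead n i) * X ^ i := by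
      have : C ((n : ℝ) - 1 + i) * C (gegLead n (i + 2)) =
          C ((n : ℝ) + 2 * i) * C (gegLead n (i + 1)) := by
        rw [← C_mul, ← C_mul]
        congr 1
        linear_combination hl
      rw [mul_sub, gegenbauer_recurrence hn, C_mul]
      linear_combination - X ^ (i + 2) * this
    rw [e]
    refine sub_mem (sub_mem (C_mul_mem_degreeLT _ ?_) (C_mul_mem_degreeLT _ ?_))
      (C_mul_mem_degreeLT _ (X_pow_mem_degreeLT (by omega)))
    · rcases i with _ | i
      · simp [gegenbauer, gegLead_one hn]
      · exact mul_mem_degreeLT X_mem_degreeLT ih1 (by omega)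
    · exact mem_degreeLT_mono (by omega) ih0

lemma gegenbauer_mem_degreeLT (hn : 3 ≤ n) (i : ℕ) : gegenbauer n i ∈ degreeLT ℝ (i + 1) := by
  have h := mem_degreeLT_mono (b := i + 1) (by omega) (gegenbauer_sub_lead_mem hn i)
  have := add_mem h (C_mul_mem_degreeLT (gegLead n i) (X_pow_mem_degreeLT (Nat.lt_succ_self i)))
  simpa using this

/-- The ratio `-s` of the coefficients of `X ^ i` and `X ^ (i + 2)` in `P_{i+2}^{(n)}`. -/
def gegSub (n i : ℕ) : ℝ := ((i : ℝ) + 2) * (i + 1) / (2 * (n + 2 * i))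

/-- The second coefficient is needed to locate the t^{2k} term of q r relative to P_{2k+2}. -/
lemma gegenbauer_sub_lead_two_mem (hn : 3 ≤ n) (i : ℕ) :
    gegenbauer n (i + 2) - C (gegLead n (i + 2)) * (X ^ (i + 2) - C (gegSub n i) * X ^ i) ∈
      degreeLT ℝ i := by
  have h3 := cast_ge_three hn
  induction i with
  | zero =>
    have hc : (n : ℝ) - 1 + (0 : ℕ) ≠ 0 := by push_cast; linarith
    have hc' : (n : ℝ) ≠ 0 := by linarith
    apply mem_degreeLT_of_C_mul_mem hc
    have hl := gegLead_succ hn 1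
    rw [gegLead_one hn] at hl
    push_cast at hl
    have h1 : C ((n : ℝ) - 1 + (0 : ℕ)) * C (gegLead n 2) = C (n : ℝ) := by
      rw [← C_mul]
      congr 1
      push_cast
      linear_combination hl
    have h2 : C (n : ℝ) * C (gegSub n 0) = 1 := by
      rw [← C_mul, ← C_1, gegSub]
      congr 1
      push_cast
      field_simp
      ring
    have : C ((n : ℝ) - 1 + (0 : ℕ)) * (gegenbauer n (0 + 2) -
        C (gegLead n (0 + 2)) * (X ^ (0 + 2) - C (gegSub n 0) * X ^ 0)) = 0 := by
      rw [mul_sub, gegenbauer_recurrence hn, gegenbauer_one, gegenbauer_zero]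
      simp only [Nat.cast_zero, mul_zero, add_zero, zero_add, C_1] at h1 h2 ⊢
      linear_combination (-X ^ 2 + C (gegSub n 0)) * h1 + h2
    rw [this]
    exact zero_mem _
  | succ i ih =>
    have hi : (0 : ℝ) ≤ i := i.cast_nonneg
    have hc : (n : ℝ) - 1 + (i + 1 : ℕ) ≠ 0 := by push_cast; linarith
    apply mem_degreeLT_of_C_mul_mem hc
    have hl := gegLead_succ hn (i + 2)
    have hl1 := gegLead_succ hn (i + 1)
    push_cast at hl hl1
    have h1 : C ((n : ℝ) - 1 + (i + 1 : ℕ)) * C (gegLead n (i + 3)) =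
        C ((n : ℝ) + 2 * (i + 1 : ℕ)) * C (gegLead n (i + 2)) := by
      rw [← C_mul, ← C_mul]
      congr 1
      push_cast
      linear_combination hl
    have h2 : C ((n : ℝ) - 1 + (i + 1 : ℕ)) * C (gegLead n (i + 3)) * C (gegSub n (i + 1)) =
        C ((n : ℝ) + 2 * (i + 1 : ℕ)) * (C (gegLead n (i + 2)) * C (gegSub n i)) +
          C (((i + 1 : ℕ) : ℝ) + 1) * C (gegLead n (i + 1)) := by
      rw [h1]
      simp only [← C_mul, ← C_add]
      congr 1
      have e : (n + 2 * i) * gegLead n (i + 1) = (n - 1 + i) * gegLead n (i + 2) := by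
        linear_combination - hl1
      have hn2 : (n : ℝ) + 2 * i ≠ 0 := by linarith
      have hn3 : (n : ℝ) + 2 * (i + 1) ≠ 0 := by linarith
      have e' : gegLead n (i + 1) = (n - 1 + i) * gegLead n (i + 2) / (n + 2 * i) := by
        field_simp
        linear_combination e
      rw [e', gegSub, gegSub]
      push_cast
      field_simp
      ring
    have e : C ((n : ℝ) - 1 + (i + 1 : ℕ)) * (gegenbauer n (i + 1 + 2) -
        C (gegLead n (i + 1 + 2)) * (X ^ (i + 1 + 2) - C (gegSub n (i + 1)) * X ^ (i + 1))) =
        C ((n : ℝ) + 2 * (i + 1 : ℕ)) * (X * (gegenbauer n (i + 2) -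
          C (gegLead n (i + 2)) * (X ^ (i + 2) - C (gegSub n i) * X ^ i))) -
        C (((i + 1 : ℕ) : ℝ) + 1) *
          (gegenbauer n (i + 1) - C (gegLead n (i + 1)) * X ^ (i + 1)) := by
      rw [mul_sub, gegenbauer_recurrence hn]
      linear_combination - X ^ (i + 3) * h1 + X ^ (i + 1) * h2
    rw [e]
    refine sub_mem (C_mul_mem_degreeLT _ ?_) (C_mul_mem_degreeLT _ ?_)
    · exact mul_mem_degreeLT X_mem_degreeLT ih (by omega)
    · exact mem_degreeLT_mono (by omega) (gegenbauer_sub_lead_mem hn (i + 1))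

lemma coeff_eq_zero_of_mem {f : ℝ[X]} {d i : ℕ} (hf : f ∈ degreeLT ℝ d) (hi : d ≤ i) :
    f.coeff i = 0 := by
  rw [mem_degreeLT, degree_lt_iff_coeff_zero] at hf
  exact hf i hi

lemma sub_C_mul_gegenbauer_mem (hn : 3 ≤ n) {d : ℕ} {f : ℝ[X]} (hf : f ∈ degreeLT ℝ (d + 1)) :
    f - C (f.coeff d / gegLead n d) * gegenbauer n d ∈ degreeLT ℝ d := by
  have hl := (gegLead_pos hn d).ne'
  rw [mem_degreeLT, degree_lt_iff_coeff_zero]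
  intro i hi
  rcases hi.eq_or_lt with rfl | hi
  · have := coeff_eq_zero_of_mem (gegenbauer_sub_lead_mem hn d) (Nat.sub_le d 1)
    simp only [coeff_sub, coeff_C_mul, coeff_X_pow, if_true, mul_one, sub_eq_zero] at this
    simp [this, hl]
  · simp [coeff_eq_zero_of_mem hf hi, coeff_eq_zero_of_mem (gegenbauer_mem_degreeLT hn d) hi]

/-- A linear functional vanishing on `P_0, …, P_{d-1}` vanishes on polynomials of degree `< d`. -/
lemma eq_zero_of_mem_degreeLT (hn : 3 ≤ n) (F : ℝ[X] →ₗ[ℝ] ℝ) {d : ℕ}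
    (hF : ∀ i < d, F (gegenbauer n i) = 0) {f : ℝ[X]} (hf : f ∈ degreeLT ℝ d) : F f = 0 := by
  induction d generalizing f with
  | zero =>
    have : f = 0 := by
      ext m
      exact coeff_eq_zero_of_mem hf (Nat.zero_le m)
    rw [this, map_zero]
  | succ d ih =>
    have := ih (fun i hi => hF i (by omega)) (sub_C_mul_gegenbauer_mem hn hf)
    rwa [map_sub, ← smul_eq_C_mul, map_smul, hF d (by omega), smul_zero, sub_zero] at this

/-- This structure relation turns integration by parts into a recursion for the means. -/
lemma one_sub_X_sq_mul_derivative_gegenbauer (hn : 3 ≤ n) (i : ℕ) :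
    (1 - X ^ 2) * derivative (gegenbauer n (i + 1)) =
      C ((i : ℝ) + 1) * (gegenbauer n i - X * gegenbauer n (i + 1)) := by
  have h3 := cast_ge_three hn
  -- Two consecutive indices are carried together, since the differentiated three-term recurrence
  -- involves both.
  suffices h : (1 - X ^ 2) * derivative (gegenbauer n (i + 1)) =
      C ((i : ℝ) + 1) * (gegenbauer n i - X * gegenbauer n (i + 1)) ∧
      (1 - X ^ 2) * derivative (gegenbauer n (i + 2)) =
      C ((i : ℝ) + 2) * (gegenbauer n (i + 1) - X * gegenbauer n (i + 2)) from h.1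
  induction i with
  | zero =>
    have r := gegenbauer_recurrence hn 0
    have hc : C ((n : ℝ) - 1) ≠ 0 := by
      rw [Ne, C_eq_zero]
      linarith
    have d := congrArg derivative r
    simp only [gegenbauer_one, gegenbauer_zero, derivative_mul,
      derivative_X, derivative_one, derivative_natCast, derivative_ofNat, map_add,
      map_sub, map_mul, map_natCast, map_ofNat, map_one, map_zero, zero_add,
      Nat.cast_zero] at r d hc ⊢
    refine ⟨by ring, mul_left_cancel₀ hc ?_⟩
    linear_combination (1 - X ^ 2) * d + 2 * X * r
  | succ j ih =>
    obtain ⟨a1, a2⟩ := ih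
    refine ⟨?_, ?_⟩
    · rw [a2]
      congr 2
      push_cast
      ring
    have r0 := gegenbauer_recurrence hn j
    have r := gegenbauer_recurrence hn (j + 1)
    have d := congrArg derivative r
    have hc : C ((n : ℝ) + j) ≠ 0 := by
      rw [Ne, C_eq_zero]
      have : (0 : ℝ) ≤ j := j.cast_nonneg
      linarith
    push_cast at r d ⊢
    simp only [derivative_mul, derivative_X, map_add, map_sub, map_mul, map_natCast, map_ofNat, map_one, derivative_natCast,
      derivative_one, derivative_ofNat] at r0 r d a1 a2 hc ⊢
    refine mul_left_cancel₀ hc ?_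
    linear_combination (1 - X ^ 2) * d + ((n : ℝ[X]) + 2 * (j + 1)) * X * a2 -
      ((j : ℝ[X]) + 2) * a1 + ((j : ℝ[X]) + 3) * X * r - ((j : ℝ[X]) + 2) * r0

/-! ### The mean as a positive linear functional -/

lemma continuous_weight (hn : 3 ≤ n) : Continuous (weight n) := by
  have h3 := cast_ge_three hn
  exact (by fun_prop : Continuous fun t : ℝ => 1 - t ^ 2).rpow_const
    fun _ => Or.inr (by linarith)

lemma weight_nonneg {t : ℝ} (ht : t ∈ Set.Icc (-1 : ℝ) 1) : 0 ≤ weight n t :=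
  Real.rpow_nonneg (by nlinarith [ht.1, ht.2]) _

lemma weight_pos {t : ℝ} (ht : t ∈ Set.Ioo (-1 : ℝ) 1) : 0 < weight n t :=
  Real.rpow_pos_of_pos (by nlinarith [ht.1, ht.2]) _

lemma intervalIntegrable_mul_weight (hn : 3 ≤ n) (f : ℝ[X]) :
    IntervalIntegrable (fun t => f.eval t * weight n t) MeasureTheory.volume (-1) 1 :=
  (f.continuous.mul (continuous_weight hn)).intervalIntegrable _ _

lemma integral_eval_mul_weight_pos (hn : 3 ≤ n) {f : ℝ[X]} (h0 : f ≠ 0)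
    (hf : ∀ t ∈ Set.Ioo (-1 : ℝ) 1, 0 ≤ f.eval t) :
    0 < ∫ t in (-1 : ℝ)..1, f.eval t * weight n t := by
  obtain ⟨t, ht, hft⟩ : ∃ t ∈ Set.Ioo (-1 : ℝ) 1, f.eval t ≠ 0 := by
    by_contra! h
    exact h0 (eq_zero_of_infinite_isRoot f
      ((Set.Ioo_infinite (by norm_num : (-1 : ℝ) < 1)).mono fun t ht => h t ht))
  have hc : Continuous fun t => f.eval t * weight n t := f.continuous.mul (continuous_weight hn)
  have hcl : ∀ t ∈ Set.Icc (-1 : ℝ) 1, 0 ≤ f.eval t := by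
    have : Set.Icc (-1 : ℝ) 1 ⊆ {t | 0 ≤ f.eval t} := by
      rw [← closure_Ioo (by norm_num : (-1 : ℝ) ≠ 1)]
      exact closure_minimal hf (isClosed_le continuous_const f.continuous)
    exact this
  refine intervalIntegral.integral_pos (by norm_num) hc.continuousOn
    (fun s hs => mul_nonneg (hcl s (Set.Ioc_subset_Icc_self hs))
      (weight_nonneg (Set.Ioc_subset_Icc_self hs)))
    ⟨t, Set.Ioo_subset_Icc_self ht, mul_pos ((hf t ht).lt_of_ne' hft) (weight_pos ht)⟩

lemma integral_weight_pos (hn : 3 ≤ n) : 0 < ∫ t in (-1 : ℝ)..1, weight n t := by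
  simpa using integral_eval_mul_weight_pos hn (f := 1) one_ne_zero (by simp)

/-- The mean `∫ f dμ_n` as a linear functional on polynomials. -/
def meanLM (hn : 3 ≤ n) : ℝ[X] →ₗ[ℝ] ℝ where
  toFun f := mean n fun t => f.eval t
  map_add' f g := by
    simp only [mean, eval_add, add_mul]
    rw [intervalIntegral.integral_add (intervalIntegrable_mul_weight hn f)
      (intervalIntegrable_mul_weight hn g), add_div]
  map_smul' r f := by
    simp only [mean, eval_smul, smul_eq_mul, mul_assoc, RingHom.id_apply]
    rw [intervalIntegral.integral_const_mul, mul_div_assoc]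

lemma meanLM_apply (hn : 3 ≤ n) (f : ℝ[X]) : meanLM hn f = mean n fun t => f.eval t := rfl

lemma meanLM_one (hn : 3 ≤ n) : meanLM hn 1 = 1 := by
  simp only [meanLM_apply, mean, eval_one, one_mul]
  exact div_self (integral_weight_pos hn).ne'

lemma map_C_mul (F : ℝ[X] →ₗ[ℝ] ℝ) (r : ℝ) (f : ℝ[X]) : F (C r * f) = r * F f := by
  rw [← smul_eq_C_mul, map_smul, smul_eq_mul]

lemma meanLM_pos (hn : 3 ≤ n) {f : ℝ[X]} (h0 : f ≠ 0)
    (hf : ∀ t ∈ Set.Ioo (-1 : ℝ) 1, 0 ≤ f.eval t) : 0 < meanLM hn f :=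
  div_pos (integral_eval_mul_weight_pos hn h0 hf) (integral_weight_pos hn)

lemma meanLM_sq_pos (hn : 3 ≤ n) {f : ℝ[X]} (h0 : f ≠ 0) : 0 < meanLM hn (f ^ 2) :=
  meanLM_pos hn (pow_ne_zero 2 h0) fun t _ => by rw [eval_pow]; positivity

/-- The integrand is the derivative of (1 - t²)^{(n-1)/2} g(t), which vanishes at ±1 because the
exponent is positive. -/
lemma meanLM_by_parts (hn : 3 ≤ n) (g : ℝ[X]) :
    meanLM hn ((1 - X ^ 2) * derivative g - C ((n : ℝ) - 1) * (X * g)) = 0 := by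
  have h3 := cast_ge_three hn
  rw [meanLM_apply, mean]
  have key : ∫ t in (-1 : ℝ)..1, ((1 - X ^ 2) * derivative g -
      C ((n : ℝ) - 1) * (X * g)).eval t * weight n t =
      (fun t : ℝ => (1 - t ^ 2) ^ (((n : ℝ) - 3) / 2 + 1) * g.eval t) 1 -
      (fun t : ℝ => (1 - t ^ 2) ^ (((n : ℝ) - 3) / 2 + 1) * g.eval t) (-1) := by
    refine intervalIntegral.integral_eq_sub_of_hasDerivAt
      (f := fun t : ℝ => (1 - t ^ 2) ^ (((n : ℝ) - 3) / 2 + 1) * g.eval t) (fun t ht => ?_)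
      (intervalIntegrable_mul_weight hn _)
    rw [Set.uIcc_of_le (by norm_num)] at ht
    have h1 : HasDerivAt (fun t : ℝ => 1 - t ^ 2) (-(2 * t)) t := by
      simpa using (hasDerivAt_pow 2 t).const_sub 1
    have h2 := (h1.rpow_const (p := ((n : ℝ) - 3) / 2 + 1)
      (Or.inr (by linarith))).mul (g.hasDerivAt t)
    refine HasDerivAt.congr_deriv (f' := _) h2 ?_
    have e : (1 - t ^ 2) ^ (((n : ℝ) - 3) / 2 + 1) = weight n t * (1 - t ^ 2) := by
      rw [Real.rpow_add_one' (by nlinarith [ht.1, ht.2]) (by linarith), weight]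
    rw [e, add_sub_cancel_right]
    simp only [eval_sub, eval_mul, eval_one, eval_pow, eval_X, eval_C]
    rw [← weight]
    ring
  rw [key]
  have : ((n : ℝ) - 3) / 2 + 1 ≠ 0 := by linarith
  simp [Real.zero_rpow this]

/-! ### Orthogonality -/

lemma X_mul_gegenbauer (hn : 3 ≤ n) (i : ℕ) :
    X * gegenbauer n (i + 1) = C (((n : ℝ) - 1 + i) / (n + 2 * i)) * gegenbauer n (i + 2) +
      C (((i : ℝ) + 1) / (n + 2 * i)) * gegenbauer n i := by
  have h3 := cast_ge_three hn
  have h0 : (n : ℝ) + 2 * i ≠ 0 := by positivity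
  apply mul_left_cancel₀ (C_ne_zero.2 h0)
  rw [mul_add, ← mul_assoc, ← mul_assoc, ← mul_assoc, ← C_mul, ← C_mul,
    mul_div_cancel₀ _ h0, mul_div_cancel₀ _ h0, gegenbauer_recurrence hn]
  ring

lemma meanLM_X_mul_gegenbauer_mul (hn : 3 ≤ n) (i : ℕ) (g : ℝ[X]) :
    meanLM hn (X * gegenbauer n (i + 1) * g) =
      ((n : ℝ) - 1 + i) / (n + 2 * i) * meanLM hn (gegenbauer n (i + 2) * g) +
      ((i : ℝ) + 1) / (n + 2 * i) * meanLM hn (gegenbauer n i * g) := by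
  rw [X_mul_gegenbauer hn, add_mul, mul_assoc, mul_assoc, map_add, map_C_mul, map_C_mul]

/-- Integration by parts applied to P_{i+1} links the means of P_{i+2} and P_i. The factor i on the
right kills the even chain at its start; the odd chain starts from the mean of t, which is zero. -/
lemma meanLM_gegenbauer (hn : 3 ≤ n) (i : ℕ) : meanLM hn (gegenbauer n (i + 1)) = 0 := by
  have h3 := cast_ge_three hn
  have h1 : meanLM hn X = 0 := by
    have := meanLM_by_parts hn 1
    rw [derivative_one, mul_zero, zero_sub, map_neg, map_C_mul, mul_one, neg_eq_zero] at this
    exact (mul_eq_zero.1 this).resolve_left (by linarith)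
  have hrec : ∀ i : ℕ, meanLM hn (gegenbauer n (i + 2)) *
      (((n : ℝ) + i) * (n - 1 + i)) = i * (i + 1) * meanLM hn (gegenbauer n i) := by
    intro i
    have := meanLM_by_parts hn (gegenbauer n (i + 1))
    rw [one_sub_X_sq_mul_derivative_gegenbauer hn, map_sub, map_C_mul, map_C_mul, map_sub,
      X_mul_gegenbauer hn, map_add, map_C_mul, map_C_mul] at this
    have h0 : (n : ℝ) + 2 * i ≠ 0 := by positivity
    field_simp at this
    linear_combination -this
  induction i using Nat.twoStepInduction with
  | zero => rw [gegenbauer_one, h1]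
  | one =>
    have := hrec 0
    simp only [Nat.cast_zero, zero_mul, add_zero, zero_add] at this
    exact (mul_eq_zero.1 this).resolve_right (mul_ne_zero (by linarith) (by linarith))
  | more i ih _ =>
    have := hrec (i + 1)
    rw [ih, mul_zero] at this
    refine (mul_eq_zero.1 this).resolve_right (mul_ne_zero ?_ ?_)
    · positivity
    · have : (0 : ℝ) ≤ (i + 1 : ℕ) := Nat.cast_nonneg _
      linarith

/-- Induction on the smaller index: the recurrence lowers it, and the factor t that appears is moved
onto the larger-index polynomial. -/
lemma meanLM_gegenbauer_mul_of_lt (hn : 3 ≤ n) {i j : ℕ} (h : j < i) :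
    meanLM hn (gegenbauer n i * gegenbauer n j) = 0 := by
  have h3 := cast_ge_three hn
  induction j using Nat.twoStepInduction generalizing i with
  | zero =>
    obtain ⟨i, rfl⟩ := Nat.exists_eq_add_of_lt h
    rw [gegenbauer_zero, mul_one, zero_add, meanLM_gegenbauer hn]
  | one =>
    obtain ⟨i, rfl⟩ := Nat.exists_eq_add_of_lt h
    rw [gegenbauer_one, mul_comm, (by omega : 1 + i + 1 = i + 1 + 1), X_mul_gegenbauer hn,
      map_add, map_C_mul, map_C_mul, meanLM_gegenbauer hn, meanLM_gegenbauer hn]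
    simp
  | more j ih0 ih1 =>
    obtain ⟨i, rfl⟩ := Nat.exists_eq_add_of_lt h
    have hc : (n : ℝ) - 1 + j ≠ 0 := by
      have : (0 : ℝ) ≤ j := Nat.cast_nonneg _
      linarith
    apply mul_left_cancel₀ hc
    have e : C ((n : ℝ) - 1 + j) * (gegenbauer n (j + 2 + i + 1) * gegenbauer n (j + 2)) =
        C ((n : ℝ) + 2 * j) *
          ((X * gegenbauer n (j + 1 + i + 1 + 1)) * gegenbauer n (j + 1)) -
        C ((j : ℝ) + 1) * (gegenbauer n (j + 2 + i + 1) * gegenbauer n j) := by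
      rw [(by omega : j + 1 + i + 1 + 1 = j + 2 + i + 1)]
      linear_combination gegenbauer n (j + 2 + i + 1) * gegenbauer_recurrence hn j
    rw [← map_C_mul, e, map_sub, map_C_mul, map_C_mul, meanLM_X_mul_gegenbauer_mul hn,
      ih1 (by omega), ih1 (by omega), ih0 (by omega)]
    simp

lemma meanLM_gegenbauer_mul_of_mem (hn : 3 ≤ n) {i : ℕ} {f : ℝ[X]} (hf : f ∈ degreeLT ℝ i) :
    meanLM hn (gegenbauer n i * f) = 0 :=
  eq_zero_of_mem_degreeLT hn (meanLM hn ∘ₗ LinearMap.mulLeft ℝ (gegenbauer n i))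
    (fun _ hj => meanLM_gegenbauer_mul_of_lt hn hj) hf

lemma gegenbauer_ne_zero (hn : 3 ≤ n) (i : ℕ) : gegenbauer n i ≠ 0 := by
  intro h
  have := gegenbauer_sub_lead_mem hn i
  rw [h, mem_degreeLT, degree_lt_iff_coeff_zero] at this
  simpa [(gegLead_pos hn i).ne'] using this i (by omega)

/-- The mean of t P_{i+1} P_i is computed twice, expanding either t P_{i+1} or t P_i. -/
lemma meanLM_gegenbauer_sq_succ (hn : 3 ≤ n) (i : ℕ) :
    meanLM hn (gegenbauer n (i + 1) ^ 2) * (((n : ℝ) - 2 + i) * (n + 2 * i)) =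
      meanLM hn (gegenbauer n i ^ 2) * ((i + 1) * (n - 2 + 2 * i)) := by
  have h3 := cast_ge_three hn
  have h0 : (n : ℝ) + 2 * i ≠ 0 := by positivity
  have e1 : meanLM hn (X * gegenbauer n (i + 1) * gegenbauer n i) =
      (i + 1) / (n + 2 * i) * meanLM hn (gegenbauer n i ^ 2) := by
    rw [meanLM_X_mul_gegenbauer_mul hn, meanLM_gegenbauer_mul_of_lt hn (by omega), ← sq,
      mul_zero, zero_add]
  have e2 : ((n : ℝ) - 2 + 2 * i) * meanLM hn (X * gegenbauer n (i + 1) * gegenbauer n i) =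
      (n - 2 + i) * meanLM hn (gegenbauer n (i + 1) ^ 2) := by
    rcases i with _ | i
    · rw [zero_add, gegenbauer_one, gegenbauer_zero, Nat.cast_zero, mul_one, sq]
      ring
    · have h0' : (n : ℝ) + 2 * i ≠ 0 := by positivity
      rw [mul_right_comm, meanLM_X_mul_gegenbauer_mul hn, ← sq, mul_comm (gegenbauer n i),
        meanLM_gegenbauer_mul_of_lt hn (by omega)]
      push_cast
      field_simp
      ring
  rw [e1] at e2
  field_simp at e2
  linear_combination -e2

/-! ### The Fischer product and zonal harmonics -/

section Fischer

open MvPolynomial (pderiv)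

lemma pderiv_pderiv_comm {σ : Type*} (i j : σ) (p : MvPolynomial σ ℝ) :
    pderiv i (pderiv j p) = pderiv j (pderiv i p) := by
  classical
  ext m
  simp only [MvPolynomial.coeff_pderiv]
  by_cases h : i = j
  · rw [h]
  · simp [Finsupp.single_eq_of_ne h, Finsupp.single_eq_of_ne (Ne.symm h)]
    rw [add_right_comm]
    ring

lemma isHomogeneous_C_mul {σ : Type*} {d : ℕ} (r : ℝ) {p : MvPolynomial σ ℝ} (hp : p.IsHomogeneous d) :
    (MvPolynomial.C r * p).IsHomogeneous d := by
  simpa using (MvPolynomial.isHomogeneous_C σ r).mul hp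

variable {σ : Type*} [Fintype σ]

/-- The Fischer product `⟨p, q⟩ = p(∂) q |_{z = 0}` of real polynomials. -/
def fischer (p q : MvPolynomial σ ℝ) : ℝ :=
  ∑ m ∈ p.support, p.coeff m * (∏ i, ((m i).factorial : ℝ)) * q.coeff m

lemma fischer_eq_sum {p : MvPolynomial σ ℝ} {s : Finset (σ →₀ ℕ)} (h : p.support ⊆ s)
    (q : MvPolynomial σ ℝ) :
    fischer p q = ∑ m ∈ s, p.coeff m * (∏ i, ((m i).factorial : ℝ)) * q.coeff m :=
  Finset.sum_subset h fun m _ hm => by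
    rw [MvPolynomial.notMem_support_iff.1 hm, zero_mul, zero_mul]

lemma fischer_add_left (p₁ p₂ q : MvPolynomial σ ℝ) :
    fischer (p₁ + p₂) q = fischer p₁ q + fischer p₂ q := by
  classical
  rw [fischer_eq_sum MvPolynomial.support_add, fischer_eq_sum Finset.subset_union_left,
    fischer_eq_sum Finset.subset_union_right, ← Finset.sum_add_distrib]
  refine Finset.sum_congr rfl fun m _ => ?_
  rw [MvPolynomial.coeff_add]
  ring

lemma fischer_monomial (m : σ →₀ ℕ) (a : ℝ) (q : MvPolynomial σ ℝ) :
    fischer (MvPolynomial.monomial m a) q = a * (∏ i, ((m i).factorial : ℝ)) * q.coeff m := by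
  classical
  rw [fischer_eq_sum MvPolynomial.support_monomial_subset, Finset.sum_singleton,
    MvPolynomial.coeff_monomial, if_pos rfl]

lemma fischer_C_mul_left (r : ℝ) (p q : MvPolynomial σ ℝ) :
    fischer (MvPolynomial.C r * p) q = r * fischer p q := by
  induction p using MvPolynomial.induction_on' with
  | monomial m a => rw [MvPolynomial.C_mul_monomial, fischer_monomial, fischer_monomial]; ring
  | add p₁ p₂ h₁ h₂ => rw [mul_add, fischer_add_left, h₁, h₂, fischer_add_left]; ring

lemma fischer_add_right (p q₁ q₂ : MvPolynomial σ ℝ) :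
    fischer p (q₁ + q₂) = fischer p q₁ + fischer p q₂ := by
  simp only [fischer, MvPolynomial.coeff_add, mul_add, Finset.sum_add_distrib]

lemma fischer_C_mul_right (r : ℝ) (p q : MvPolynomial σ ℝ) :
    fischer p (MvPolynomial.C r * q) = r * fischer p q := by
  simp only [fischer, MvPolynomial.coeff_C_mul, Finset.mul_sum]
  exact Finset.sum_congr rfl fun _ _ => by ring

lemma fischer_sum_left {ι : Type*} (s : Finset ι) (p : ι → MvPolynomial σ ℝ)
    (q : MvPolynomial σ ℝ) : fischer (∑ i ∈ s, p i) q = ∑ i ∈ s, fischer (p i) q :=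
  map_sum (AddMonoidHom.mk' (fun p => fischer p q) fun a b => fischer_add_left a b q) p s

lemma fischer_sum_right {ι : Type*} (s : Finset ι) (p : MvPolynomial σ ℝ)
    (q : ι → MvPolynomial σ ℝ) : fischer p (∑ i ∈ s, q i) = ∑ i ∈ s, fischer p (q i) :=
  map_sum (AddMonoidHom.mk' (fun q => fischer p q) fun a b => fischer_add_right p a b) q s

lemma eq_zero_of_fischer_self {p : MvPolynomial σ ℝ} (h : fischer p p = 0) : p = 0 := by
  rw [fischer, Finset.sum_eq_zero_iff_of_nonneg] at h
  · ext m
    by_contra hm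
    rw [MvPolynomial.coeff_zero] at hm
    have := h m (MvPolynomial.mem_support_iff.2 hm)
    have hp : (∏ i, ((m i).factorial : ℝ)) ≠ 0 :=
      Finset.prod_ne_zero_iff.2 fun i _ => by positivity
    simp_all
  · intro m _
    have : 0 ≤ ∏ i, ((m i).factorial : ℝ) := Finset.prod_nonneg fun _ _ => by positivity
    nlinarith [mul_nonneg this (mul_self_nonneg (p.coeff m))]

/-- Multiplication by a variable is adjoint to its partial derivative because (m_i + 1)! = (m_i + 1)
· m_i!. Multiplication by y · z and by |z|² is then adjoint to the directional derivative and to the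
Laplacian. -/
lemma fischer_X_mul (i : σ) (p q : MvPolynomial σ ℝ) :
    fischer (MvPolynomial.X i * p) q = fischer p (pderiv i q) := by
  classical
  induction p using MvPolynomial.induction_on' with
  | monomial m a =>
    have : MvPolynomial.X i * MvPolynomial.monomial m a =
        MvPolynomial.monomial (m + Finsupp.single i 1) a := by
      rw [MvPolynomial.X, MvPolynomial.monomial_mul, one_mul, add_comm]
    rw [this, fischer_monomial, fischer_monomial, MvPolynomial.coeff_pderiv,
      ← Finset.mul_prod_erase _ _ (Finset.mem_univ i),
      ← Finset.mul_prod_erase Finset.univ (fun j => ((m j).factorial : ℝ)) (Finset.mem_univ i)]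
    have h1 : ∏ j ∈ Finset.univ.erase i, (((m + Finsupp.single i 1 : σ →₀ ℕ) j).factorial : ℝ) =
        ∏ j ∈ Finset.univ.erase i, ((m j).factorial : ℝ) := by
      refine Finset.prod_congr rfl fun j hj => ?_
      rw [Finsupp.add_apply, Finsupp.single_eq_of_ne (Finset.ne_of_mem_erase hj), add_zero]
    rw [h1, Finsupp.add_apply, Finsupp.single_eq_same, Nat.factorial_succ]
    push_cast
    ring
  | add p₁ p₂ h₁ h₂ => rw [mul_add, fischer_add_left, h₁, h₂, fischer_add_left]

/-- The Laplacian of a polynomial. -/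
def laplacian (p : MvPolynomial σ ℝ) : MvPolynomial σ ℝ := ∑ i, pderiv i (pderiv i p)

/-- The derivative of a polynomial in the direction `y`. -/
def dirDeriv (y : σ → ℝ) (p : MvPolynomial σ ℝ) : MvPolynomial σ ℝ :=
  ∑ i, MvPolynomial.C (y i) * pderiv i p

/-- The linear form `z ↦ y · z`. -/
def linForm (y : σ → ℝ) : MvPolynomial σ ℝ := ∑ i, MvPolynomial.C (y i) * MvPolynomial.X i

variable (σ) in
/-- The quadratic form `z ↦ z · z`. -/
def normSqForm : MvPolynomial σ ℝ := ∑ i, MvPolynomial.X i ^ 2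

lemma fischer_linForm_mul (y : σ → ℝ) (p q : MvPolynomial σ ℝ) :
    fischer (linForm y * p) q = fischer p (dirDeriv y q) := by
  rw [linForm, dirDeriv, Finset.sum_mul, fischer_sum_left, fischer_sum_right]
  refine Finset.sum_congr rfl fun i _ => ?_
  rw [mul_assoc, fischer_C_mul_left, fischer_X_mul, fischer_C_mul_right]

lemma fischer_normSqForm_mul (p q : MvPolynomial σ ℝ) :
    fischer (normSqForm σ * p) q = fischer p (laplacian q) := by
  rw [normSqForm, laplacian, Finset.sum_mul, fischer_sum_left, fischer_sum_right]
  refine Finset.sum_congr rfl fun i _ => ?_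
  rw [sq, mul_assoc, fischer_X_mul, fischer_X_mul]

lemma pderiv_linForm (y : σ → ℝ) (i : σ) : pderiv i (linForm y) = MvPolynomial.C (y i) := by
  classical
  simp [linForm, MvPolynomial.pderiv_X, Pi.single_apply]

lemma pderiv_normSqForm (i : σ) :
    pderiv i (normSqForm σ) = 2 * (MvPolynomial.X i : MvPolynomial σ ℝ) := by
  classical
  simp [normSqForm, MvPolynomial.pderiv_X, Pi.single_apply]

lemma laplacian_linForm_mul (y : σ → ℝ) (p : MvPolynomial σ ℝ) :
    laplacian (linForm y * p) = 2 * dirDeriv y p + linForm y * laplacian p := by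
  rw [laplacian, laplacian, dirDeriv, Finset.mul_sum, Finset.mul_sum, ← Finset.sum_add_distrib]
  refine Finset.sum_congr rfl fun i _ => ?_
  simp only [MvPolynomial.pderiv_mul, pderiv_linForm, map_add, MvPolynomial.pderiv_C]
  ring

/-- The term 4d comes from Euler's identity for homogeneous polynomials. -/
lemma laplacian_normSqForm_mul {d : ℕ} {p : MvPolynomial σ ℝ} (hp : p.IsHomogeneous d) :
    laplacian (normSqForm σ * p) =
      (2 * Fintype.card σ + 4 * d) * p + normSqForm σ * laplacian p := by
  have h : (4 * d : MvPolynomial σ ℝ) * p = 4 * ∑ i, MvPolynomial.X i * pderiv i p := by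
    rw [hp.sum_X_mul_pderiv, nsmul_eq_mul, mul_assoc]
  have h2 : (2 * Fintype.card σ : MvPolynomial σ ℝ) * p = ∑ _i : σ, 2 * p := by
    rw [Finset.sum_const, Finset.card_univ, nsmul_eq_mul]
    ring
  rw [add_mul, h, h2, laplacian, laplacian, Finset.mul_sum, Finset.mul_sum,
    ← Finset.sum_add_distrib, ← Finset.sum_add_distrib]
  refine Finset.sum_congr rfl fun i _ => ?_
  have h2' : pderiv i (2 : MvPolynomial σ ℝ) = 0 := by
    rw [← map_ofNat MvPolynomial.C 2, MvPolynomial.pderiv_C]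
  simp only [MvPolynomial.pderiv_mul, pderiv_normSqForm, map_add, MvPolynomial.pderiv_X_self, h2']
  ring

lemma dirDeriv_mul (y : σ → ℝ) (p q : MvPolynomial σ ℝ) :
    dirDeriv y (p * q) = dirDeriv y p * q + p * dirDeriv y q := by
  rw [dirDeriv, dirDeriv, dirDeriv, Finset.sum_mul, Finset.mul_sum, ← Finset.sum_add_distrib]
  refine Finset.sum_congr rfl fun i _ => ?_
  rw [MvPolynomial.pderiv_mul]
  ring

lemma dirDeriv_linForm (y : σ → ℝ) :
    dirDeriv y (linForm y) = MvPolynomial.C (∑ i, y i ^ 2) := by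
  simp only [dirDeriv, pderiv_linForm, map_sum, ← MvPolynomial.C_mul, sq]

lemma dirDeriv_normSqForm (y : σ → ℝ) : dirDeriv y (normSqForm σ) = 2 * linForm y := by
  rw [dirDeriv, linForm, Finset.mul_sum]
  refine Finset.sum_congr rfl fun i _ => ?_
  rw [pderiv_normSqForm]
  ring

lemma dirDeriv_C (y : σ → ℝ) (r : ℝ) : dirDeriv y (MvPolynomial.C r) = 0 := by
  simp [dirDeriv]

lemma laplacian_add (p q : MvPolynomial σ ℝ) :
    laplacian (p + q) = laplacian p + laplacian q := by
  simp [laplacian, Finset.sum_add_distrib]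

lemma laplacian_C_mul (r : ℝ) (p : MvPolynomial σ ℝ) :
    laplacian (MvPolynomial.C r * p) = MvPolynomial.C r * laplacian p := by
  simp [laplacian, Finset.mul_sum]

lemma laplacian_dirDeriv (y : σ → ℝ) (p : MvPolynomial σ ℝ) :
    laplacian (dirDeriv y p) = dirDeriv y (laplacian p) := by
  simp only [laplacian, dirDeriv, map_sum, Finset.mul_sum, MvPolynomial.pderiv_C_mul]
  rw [Finset.sum_comm]
  refine Finset.sum_congr rfl fun i _ => Finset.sum_congr rfl fun j _ => ?_
  rw [pderiv_pderiv_comm j i p, pderiv_pderiv_comm j i (pderiv j p)]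

lemma isHomogeneous_linForm (y : σ → ℝ) : (linForm y).IsHomogeneous 1 :=
  MvPolynomial.IsHomogeneous.sum _ _ _ fun i _ => by
    simpa using (MvPolynomial.isHomogeneous_C σ (y i)).mul (MvPolynomial.isHomogeneous_X ℝ i)

lemma isHomogeneous_normSqForm : (normSqForm σ).IsHomogeneous 2 :=
  MvPolynomial.IsHomogeneous.sum _ _ _ fun i _ => by
    simpa using (MvPolynomial.isHomogeneous_X ℝ i).pow 2

lemma isHomogeneous_dirDeriv {d : ℕ} (y : σ → ℝ) {p : MvPolynomial σ ℝ}
    (hp : p.IsHomogeneous (d + 1)) : (dirDeriv y p).IsHomogeneous d :=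
  MvPolynomial.IsHomogeneous.sum _ _ _ fun i _ => by
    simpa using isHomogeneous_C_mul (y i) hp.pderiv

lemma eval_dirDeriv {d : ℕ} (y : σ → ℝ) {p : MvPolynomial σ ℝ} (hp : p.IsHomogeneous d) :
    MvPolynomial.eval y (dirDeriv y p) = d * MvPolynomial.eval y p := by
  have := congrArg (MvPolynomial.eval y) hp.sum_X_mul_pderiv
  simpa [dirDeriv, map_sum] using this

/-- The zonal harmonic with pole `y`: the homogenization of `z ↦ P_i^{(n)}(y · z)`. -/
def zonal (y : σ → ℝ) : ℕ → MvPolynomial σ ℝ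
  | 0 => 1
  | 1 => linForm y
  | i + 2 =>
      MvPolynomial.C (((Fintype.card σ : ℝ) + 2 * i) / (Fintype.card σ - 1 + i)) *
          (linForm y * zonal y (i + 1)) +
        MvPolynomial.C (-(((i : ℝ) + 1) / (Fintype.card σ - 1 + i))) *
          (normSqForm σ * zonal y i)

lemma isHomogeneous_zonal (y : σ → ℝ) (i : ℕ) : (zonal y i).IsHomogeneous i := by
  induction i using Nat.twoStepInduction with
  | zero => rw [zonal]; exact MvPolynomial.isHomogeneous_one σ ℝ
  | one => rw [zonal]; exact isHomogeneous_linForm y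
  | more i ih0 ih1 =>
    rw [zonal]
    refine (isHomogeneous_C_mul _ ?_).add (isHomogeneous_C_mul _ ?_)
    · have := (isHomogeneous_linForm y).mul ih1
      rwa [(by ring : 1 + (i + 1) = i + 2)] at this
    · have := isHomogeneous_normSqForm.mul ih0
      rwa [(by ring : 2 + i = i + 2)] at this

lemma zonal_recurrence (hσ : 3 ≤ Fintype.card σ) (y : σ → ℝ) (i : ℕ) :
    MvPolynomial.C ((Fintype.card σ : ℝ) - 1 + i) * zonal y (i + 2) =
      MvPolynomial.C ((Fintype.card σ : ℝ) + 2 * i) * (linForm y * zonal y (i + 1)) -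
        MvPolynomial.C ((i : ℝ) + 1) * (normSqForm σ * zonal y i) := by
  have h3 := cast_ge_three hσ
  have hi : (0 : ℝ) ≤ i := i.cast_nonneg
  have hc : (Fintype.card σ : ℝ) - 1 + i ≠ 0 := by linarith
  rw [zonal, mul_add, ← mul_assoc, ← MvPolynomial.C_mul, mul_div_cancel₀ _ hc,
    ← mul_assoc (MvPolynomial.C ((Fintype.card σ : ℝ) - 1 + i)), ← MvPolynomial.C_mul,
    mul_neg, mul_div_cancel₀ _ hc, map_neg, neg_mul, sub_eq_add_neg]

/-- Differentiation along the pole lowers the degree. This is what makes the Laplacian of the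
recurrence computable. -/
lemma dirDeriv_zonal (hσ : 3 ≤ Fintype.card σ) {y : σ → ℝ} (hy : ∑ i, y i ^ 2 = 1) (i : ℕ) :
    dirDeriv y (zonal y (i + 1)) = MvPolynomial.C ((i : ℝ) + 1) * zonal y i := by
  have h3 := cast_ge_three hσ
  have hcm : ∀ (r : ℝ) (p : MvPolynomial σ ℝ),
      dirDeriv y (MvPolynomial.C r * p) = MvPolynomial.C r * dirDeriv y p := fun r p => by
    rw [dirDeriv_mul, dirDeriv_C, zero_mul, zero_add]
  have hsub : ∀ p q : MvPolynomial σ ℝ, dirDeriv y (p - q) = dirDeriv y p - dirDeriv y q :=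
    fun p q => by simp [dirDeriv, mul_sub]
  have hl : dirDeriv y (linForm y) = 1 := by rw [dirDeriv_linForm, hy, MvPolynomial.C_1]
  have h1 : zonal y 1 = linForm y := by rw [zonal]
  have h0 : zonal y 0 = 1 := by rw [zonal]
  induction i using Nat.twoStepInduction with
  | zero => simp [h0, h1, hl]
  | one =>
    have hc : MvPolynomial.C (σ := σ) ((Fintype.card σ : ℝ) - 1) ≠ 0 := by
      rw [Ne, MvPolynomial.C_eq_zero]
      linarith
    have d := congrArg (dirDeriv y) (zonal_recurrence hσ y 0)
    simp only [hcm, hsub] at d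
    simp only [dirDeriv_mul, h0, h1, hl, dirDeriv_normSqForm, map_add, map_sub,
      map_natCast, map_one, zero_add, Nat.cast_zero, mul_zero,
      add_zero, Nat.cast_one, mul_one, one_mul] at d hc ⊢
    refine mul_left_cancel₀ hc ?_
    linear_combination d
  | more i ih0 ih1 =>
    have hi : (0 : ℝ) ≤ i := i.cast_nonneg
    have hc : MvPolynomial.C (σ := σ) ((Fintype.card σ : ℝ) + i) ≠ 0 := by
      rw [Ne, MvPolynomial.C_eq_zero]
      linarith
    have r := zonal_recurrence hσ y i
    have d := congrArg (dirDeriv y) (zonal_recurrence hσ y (i + 1))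
    simp only [hcm, hsub, dirDeriv_mul, hl, ih0, ih1, dirDeriv_normSqForm] at d
    push_cast at d r ⊢
    simp only [map_add, map_sub, map_mul, map_natCast, map_ofNat, map_one] at r d hc ⊢
    refine mul_left_cancel₀ hc ?_
    linear_combination d - ((i : MvPolynomial σ ℝ) + 2) * r

/-- In the Laplacian of the recurrence, the contribution of 2 ∂_y from the linear form cancels the
contribution 2n + 4i from |z|². -/
lemma laplacian_zonal (hσ : 3 ≤ Fintype.card σ) {y : σ → ℝ} (hy : ∑ i, y i ^ 2 = 1) (i : ℕ) :
    laplacian (zonal y i) = 0 := by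
  have h3 := cast_ge_three hσ
  induction i using Nat.twoStepInduction with
  | zero => simp [zonal, laplacian]
  | one => simp [zonal, laplacian, pderiv_linForm]
  | more i ih0 ih1 =>
    have hi : (0 : ℝ) ≤ i := i.cast_nonneg
    have hc : (Fintype.card σ : ℝ) - 1 + i ≠ 0 := by linarith
    rw [zonal, laplacian_add, laplacian_C_mul, laplacian_C_mul, laplacian_linForm_mul,
      laplacian_normSqForm_mul (isHomogeneous_zonal y i), ih0, ih1, dirDeriv_zonal hσ hy]
    have e : MvPolynomial.C (σ := σ) (((Fintype.card σ : ℝ) + 2 * i) /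
        (Fintype.card σ - 1 + i)) * MvPolynomial.C (2 * ((i : ℝ) + 1)) =
        MvPolynomial.C (((i : ℝ) + 1) / (Fintype.card σ - 1 + i)) *
          MvPolynomial.C (2 * (Fintype.card σ : ℝ) + 4 * i) := by
      rw [← MvPolynomial.C_mul, ← MvPolynomial.C_mul]
      congr 1
      field_simp
      ring
    simp only [MvPolynomial.C_mul, MvPolynomial.C_add, map_natCast, map_ofNat] at e ⊢
    rw [map_neg]
    linear_combination zonal y i * e

/-- The constant in the reproducing property of the zonal harmonics. -/
def zonalConst (N : ℕ) : ℕ → ℝ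
  | 0 => 1
  | 1 => 1
  | i + 2 => ((N : ℝ) + 2 * i) / (N - 1 + i) * ((i + 2) * zonalConst N (i + 1))

/-- Against a harmonic q the |z|² term of the recurrence drops out by adjointness, and the y · z
term passes to ∂_y q, which is again harmonic. Euler's identity evaluates ∂_y q at y. -/
lemma fischer_zonal (y : σ → ℝ) (i : ℕ) {q : MvPolynomial σ ℝ} (hq : q.IsHomogeneous i)
    (hl : laplacian q = 0) :
    fischer (zonal y i) q = zonalConst (Fintype.card σ) i * MvPolynomial.eval y q := by
  have hconst : ∀ q : MvPolynomial σ ℝ, q.IsHomogeneous 0 →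
      fischer 1 q = MvPolynomial.eval y q := by
    intro q hq
    have : q = MvPolynomial.C (q.coeff 0) :=
      MvPolynomial.totalDegree_eq_zero_iff_eq_C.1 (Nat.le_zero.1 hq.totalDegree_le)
    rw [this, ← MvPolynomial.C_1, ← MvPolynomial.monomial_zero', fischer_monomial]
    simp
  induction i using Nat.twoStepInduction generalizing q with
  | zero => rw [zonal, zonalConst, one_mul, hconst q hq]
  | one =>
    have := eval_dirDeriv y hq
    rw [Nat.cast_one, one_mul] at this
    rw [zonal, zonalConst, one_mul, ← mul_one (linForm y), fischer_linForm_mul,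
      hconst _ (isHomogeneous_dirDeriv y hq), this]
  | more i _ ih1 =>
    rw [zonal, fischer_add_left, fischer_C_mul_left, fischer_C_mul_left, fischer_linForm_mul,
      fischer_normSqForm_mul, hl, ih1 (isHomogeneous_dirDeriv y hq), eval_dirDeriv y hq]
    · have : ∀ p : MvPolynomial σ ℝ, fischer p 0 = 0 := fun p => by simp [fischer]
      rw [this, zonalConst]
      push_cast
      ring
    · rw [laplacian_dirDeriv, hl]
      simp [dirDeriv]

lemma eval_zonal (hσ : 3 ≤ Fintype.card σ) {x : σ → ℝ} (hx : ∑ i, x i ^ 2 = 1) (y : σ → ℝ)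
    (i : ℕ) : MvPolynomial.eval x (zonal y i) =
      (gegenbauer (Fintype.card σ) i).eval (∑ j, y j * x j) := by
  have h3 := cast_ge_three hσ
  have h1 : MvPolynomial.eval x (linForm y) = ∑ j, y j * x j := by simp [linForm]
  have h2 : MvPolynomial.eval x (normSqForm σ) = 1 := by simp [normSqForm, hx]
  induction i using Nat.twoStepInduction with
  | zero => simp [zonal, gegenbauer]
  | one => simp [zonal, gegenbauer, h1]
  | more i ih0 ih1 =>
    have hi : (0 : ℝ) ≤ i := i.cast_nonneg
    have hc : (Fintype.card σ : ℝ) - 1 + i ≠ 0 := by linarith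
    have := congrArg (eval (∑ j, y j * x j)) (gegenbauer_recurrence hσ i)
    simp only [eval_mul, eval_sub, eval_C, eval_X] at this
    rw [zonal]
    simp only [map_add, map_mul, MvPolynomial.eval_C, h1, h2, ih0, ih1]
    apply mul_left_cancel₀ hc
    rw [this]
    field_simp
    ring

end Fischer

lemma sum_sq_eq_one {n : ℕ} {x : EuclideanSpace ℝ (Fin n)} (hx : ‖x‖ = 1) :
    ∑ i, x i ^ 2 = 1 := by
  have := EuclideanSpace.real_norm_sq_eq x
  rw [← this, hx, one_pow]

lemma sum_mul_eq_inner {n : ℕ} (x y : EuclideanSpace ℝ (Fin n)) :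
    ∑ i, x i * y i = inner ℝ x y := by
  rw [PiLp.inner_apply]
  exact Finset.sum_congr rfl fun i _ => by simp [mul_comm]

/-- If the `i`-th moment of a spherical code vanishes, then the sum of `P_i^{(n)}(x · y)` over
the code vanishes for every point `x` of the sphere. -/
lemma sum_gegenbauer_eq_zero_of_moment_eq_zero {n : ℕ} (hn : 3 ≤ n) {i : ℕ}
    {C : Finset (EuclideanSpace ℝ (Fin n))} (hC : ∀ y ∈ C, ‖y‖ = 1) (h : moment i C = 0)
    {x : EuclideanSpace ℝ (Fin n)} (hx : ‖x‖ = 1) :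
    ∑ y ∈ C, (gegenbauer n i).eval (inner ℝ x y) = 0 := by
  have hσ : 3 ≤ Fintype.card (Fin n) := by simpa using hn
  have hev : ∀ x y : EuclideanSpace ℝ (Fin n), ‖x‖ = 1 →
      MvPolynomial.eval x (zonal y i) = (gegenbauer n i).eval (inner ℝ x y) := by
    intro x y hx
    rw [eval_zonal hσ (sum_sq_eq_one hx), sum_mul_eq_inner, real_inner_comm, Fintype.card_fin]
  -- The Fischer square of the summed zonal harmonics is a constant times the moment, so
  -- definiteness makes the sum the zero polynomial; evaluation at x finishes.
  have h0 : ∑ y ∈ C, zonal (y : Fin n → ℝ) i = 0 := by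
    apply eq_zero_of_fischer_self
    rw [fischer_sum_left]
    have : ∀ y ∈ C, fischer (zonal (y : Fin n → ℝ) i) (∑ z ∈ C, zonal (z : Fin n → ℝ) i) =
        zonalConst n i * ∑ z ∈ C, (gegenbauer n i).eval (inner ℝ y z) := by
      intro y hy
      rw [fischer_sum_right, Finset.mul_sum]
      refine Finset.sum_congr rfl fun z hz => ?_
      rw [fischer_zonal _ _ (isHomogeneous_zonal _ _)
        (laplacian_zonal hσ (sum_sq_eq_one (hC z hz)) i), hev _ _ (hC y hy), Fintype.card_fin]
    rw [Finset.sum_congr rfl this, ← Finset.mul_sum, ← moment, h, mul_zero]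
  have := congrArg (MvPolynomial.eval (x : Fin n → ℝ)) h0
  rw [map_sum, map_zero] at this
  rw [← this]
  exact Finset.sum_congr rfl fun y _ => (hev x y hx).symm

/-! ### The coefficient of the node polynomial -/

lemma bcProd_neg (hn : 3 ≤ n) (m : ℕ) : bcProd n (m + 1) < 0 := by
  have h3 := cast_ge_three hn
  have ha : 0 < alpha n := by rw [alpha]; linarith
  rw [bcProd, neg_div, neg_lt_zero]
  push_cast
  have : alpha n + (m + 1) - 1 = alpha n + m := by ring
  rw [this, (by ring : 2 * alpha n + (m + 1) - 1 = 2 * alpha n + m)]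
  positivity

/-- The negative one of the two solutions `b > 0 > c`. -/
def cCoeff (n k : ℕ) : ℝ := bcSum n k - bCoeff n k

lemma bCoeff_add_cCoeff (n k : ℕ) : bCoeff n k + cCoeff n k = bcSum n k := by
  rw [cCoeff]
  ring

lemma bCoeff_mul_cCoeff (hn : 3 ≤ n) (m : ℕ) :
    bCoeff n (m + 1) * cCoeff n (m + 1) = bcProd n (m + 1) := by
  have h := bcProd_neg hn m
  have hs := Real.sq_sqrt (show 0 ≤ bcSum n (m + 1) ^ 2 - 4 * bcProd n (m + 1) by
    nlinarith [sq_nonneg (bcSum n (m + 1))])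
  rw [cCoeff, bCoeff]
  linear_combination -(1 / 4) * hs

lemma cCoeff_lt_bCoeff (hn : 3 ≤ n) (m : ℕ) : cCoeff n (m + 1) < bCoeff n (m + 1) := by
  have h := bcProd_neg hn m
  have hs := Real.sqrt_pos.2 (show 0 < bcSum n (m + 1) ^ 2 - 4 * bcProd n (m + 1) by
    nlinarith [sq_nonneg (bcSum n (m + 1))])
  rw [cCoeff, bCoeff]
  linarith

lemma bCoeff_pos (hn : 3 ≤ n) (m : ℕ) : 0 < bCoeff n (m + 1) := by
  have h := bcProd_neg hn m
  rw [← bCoeff_mul_cCoeff hn] at h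
  by_contra! hb
  nlinarith [cCoeff_lt_bCoeff hn m]

lemma cCoeff_neg (hn : 3 ≤ n) (m : ℕ) : cCoeff n (m + 1) < 0 := by
  have h := bcProd_neg hn m
  rw [← bCoeff_mul_cCoeff hn] at h
  exact (pos_iff_neg_of_mul_neg h).1 (bCoeff_pos hn m)

/-- The right side x is the threshold below which Λ is positive definite. Since x > 0 > c, it is
enough that the quadratic with roots b and c is positive at x. -/
lemma bCoeff_lt (hn : 3 ≤ n) (m : ℕ) :
    bCoeff n (m + 1) < ((m : ℝ) + 1) / (n - 1 + m) := by
  have h3 := cast_ge_three hn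
  have ha : 0 < alpha n := by rw [alpha]; linarith
  have hx : ((m : ℝ) + 1) / (n - 1 + m) = (m + 1) / (2 * alpha n + m + 1) := by
    rw [alpha]
    congr 1
    ring
  rw [hx]
  set x := ((m : ℝ) + 1) / (2 * alpha n + m + 1) with hxdef
  have hx0 : 0 < x := by positivity
  have hf : 0 < (x - bCoeff n (m + 1)) * (x - cCoeff n (m + 1)) := by
    have : (x - bCoeff n (m + 1)) * (x - cCoeff n (m + 1)) =
        x ^ 2 - bcSum n (m + 1) * x + bcProd n (m + 1) := by
      rw [← bCoeff_add_cCoeff, ← bCoeff_mul_cCoeff hn]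
      ring
    rw [this, bcSum, bcProd, hxdef]
    push_cast
    set a := alpha n
    -- Over a common denominator the numerator has only nonnegative terms, and positivity is visible
    -- from a > 0.
    have e : ((m + 1) / (2 * a + m + 1)) ^ 2 -
        -(2 * a * ((m : ℝ) + 1 + 1) ^ 2 * (a + (m + 1) - 1)) /
          ((2 * a + (m + 1)) * (2 * a + (m + 1) - 1) * (a + 2 * (m + 1) + 1)) *
          ((m + 1) / (2 * a + m + 1)) +
        -((m + 1 + 1) * (m + 1) * (a + (m + 1) - 1)) /
          ((2 * a + (m + 1)) * (2 * a + (m + 1) - 1) * (a + (m + 1) + 1)) =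
        (m + 1) * (8 * a ^ 3 * m + 6 * a ^ 3 + 20 * a ^ 2 * m ^ 2 + 28 * a ^ 2 * m + 12 * a ^ 2 +
          12 * a * m ^ 3 + 24 * a * m ^ 2 + 20 * a * m + 6 * a + 2 * a ^ 3 * m ^ 2 +
          4 * a ^ 2 * m ^ 3 + 2 * a * m ^ 4) /
        ((2 * a + m + 1) ^ 2 * (2 * a + m) * (a + 2 * m + 3) * (a + m + 2)) := by
      rw [(by ring : 2 * a + ((m : ℝ) + 1) - 1 = 2 * a + m),
        (by ring : 2 * a + ((m : ℝ) + 1) = 2 * a + m + 1),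
        (by ring : a + 2 * ((m : ℝ) + 1) + 1 = a + 2 * m + 3),
        (by ring : a + ((m : ℝ) + 1) + 1 = a + m + 2)]
      field_simp
      ring
    rw [e]
    positivity
  have hc := cCoeff_neg hn m
  have := (pos_iff_pos_of_mul_pos hf).2 (by linarith)
  linarith

lemma gegLead_add_two (hn : 3 ≤ n) (m : ℕ) :
    gegLead n (m + 2) = gegLead n m *
      (((n : ℝ) - 2 + 2 * m) * (n + 2 * m) / ((n - 2 + m) * (n - 1 + m))) := by
  have h3 := cast_ge_three hn
  have hm : (0 : ℝ) ≤ m := m.cast_nonneg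
  have h1 : (n : ℝ) - 2 + m ≠ 0 := by linarith
  have h2 : (n : ℝ) - 1 + m ≠ 0 := by linarith
  rw [gegLead, gegLead, (by push_cast; ring : (n : ℝ) - 2 + (m + 1 : ℕ) = n - 1 + m)]
  push_cast
  field_simp
  ring

/-- The meaning of b + c: the t^{2k} coefficients of q r and of the matching multiple of P_{2k+2}
agree. -/
lemma bcSum_mul_gegLead (hn : 3 ≤ n) (m : ℕ) :
    bcSum n (m + 1) * gegLead n m =
      gegLead n (m + 2) * (2 * gegSub n m - gegSub n (2 * m + 2)) := by
  have h3 := cast_ge_three hn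
  have hm : (0 : ℝ) ≤ m := m.cast_nonneg
  have h1 : (n : ℝ) - 2 + m ≠ 0 := by linarith
  have h2 : (n : ℝ) - 1 + m ≠ 0 := by linarith
  have h4 : (n : ℝ) + 2 * m ≠ 0 := by linarith
  have h5 : (n : ℝ) + 4 * m + 4 ≠ 0 := by linarith
  have hS : bcSum n (m + 1) = -(((n : ℝ) - 2) * (m + 2) ^ 2 * (n - 2 + 2 * m)) /
      ((n - 1 + m) * (n - 2 + m) * (n + 4 * m + 4)) := by
    rw [bcSum, alpha]
    push_cast
    rw [(by ring : 2 * ((n : ℝ) / 2 - 1) + (m + 1) - 1 = n - 2 + m),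
      (by ring : 2 * ((n : ℝ) / 2 - 1) + (m + 1) = n - 1 + m),
      (by ring : (n : ℝ) / 2 - 1 + 2 * (m + 1) + 1 = (n + 4 * m + 4) / 2)]
    field_simp
    ring
  rw [gegLead_add_two hn, hS, gegSub, gegSub]
  push_cast
  rw [(by ring : (n : ℝ) + 2 * (2 * m + 2) = n + 4 * m + 4)]
  field_simp
  ring

/-- The meaning of b c: q r has mean zero. -/
lemma meanLM_sq_add_two (hn : 3 ≤ n) (m : ℕ) :
    meanLM hn (gegenbauer n (m + 2) ^ 2) =
      -bcProd n (m + 1) * meanLM hn (gegenbauer n m ^ 2) := by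
  have h3 := cast_ge_three hn
  have hm : (0 : ℝ) ≤ m := m.cast_nonneg
  have h1 : (n : ℝ) - 2 + m ≠ 0 := by linarith
  have h2 : (n : ℝ) - 1 + m ≠ 0 := by linarith
  have h4 : (n : ℝ) + 2 * m ≠ 0 := by linarith
  have h5 : (n : ℝ) + 2 * m + 2 ≠ 0 := by linarith
  have r0 := meanLM_gegenbauer_sq_succ hn m
  have r1 := meanLM_gegenbauer_sq_succ hn (m + 1)
  have hP : bcProd n (m + 1) = -(((m : ℝ) + 2) * (m + 1) * (n - 2 + 2 * m)) /
      ((n - 1 + m) * (n - 2 + m) * (n + 2 * m + 2)) := by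
    rw [bcProd, alpha]
    push_cast
    rw [(by ring : 2 * ((n : ℝ) / 2 - 1) + (m + 1) - 1 = n - 2 + m),
      (by ring : 2 * ((n : ℝ) / 2 - 1) + (m + 1) = n - 1 + m),
      (by ring : (n : ℝ) / 2 - 1 + (m + 1) + 1 = (n + 2 * m + 2) / 2)]
    field_simp
    ring
  push_cast at r1
  rw [hP]
  set A := meanLM hn (gegenbauer n (m + 2) ^ 2)
  set B := meanLM hn (gegenbauer n (m + 1) ^ 2)
  set D := meanLM hn (gegenbauer n m ^ 2)
  have hB : B = D * ((m + 1) * (n - 2 + 2 * m)) / ((n - 2 + m) * (n + 2 * m)) := by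
    rw [eq_div_iff (mul_ne_zero h1 h4)]
    exact r0
  have hA : A = B * ((m + 2) * (n + 2 * m)) / ((n - 1 + m) * (n + 2 * m + 2)) := by
    rw [eq_div_iff (mul_ne_zero h2 h5)]
    linear_combination r1
  rw [hA, hB]
  field_simp

/-- The bound on b rewritten with norms and leading coefficients, as used in `nodeLM_sq_pos`. -/
lemma bCoeff_mul_lt (hn : 3 ≤ n) (m : ℕ) :
    bCoeff n (m + 1) * meanLM hn (gegenbauer n m ^ 2) * gegLead n (m + 1) ^ 2 <
      meanLM hn (gegenbauer n (m + 1) ^ 2) * (gegLead n (m + 2) * gegLead n m) := by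
  have h3 := cast_ge_three hn
  have hm : (0 : ℝ) ≤ m := m.cast_nonneg
  have h1 : 0 < (n : ℝ) - 2 + m := by linarith
  have h2 : 0 < (n : ℝ) - 1 + m := by linarith
  have h4 : 0 < (n : ℝ) + 2 * m := by linarith
  have h5 : 0 < (n : ℝ) - 2 + 2 * m := by linarith
  have r0 := meanLM_gegenbauer_sq_succ hn m
  have hD := meanLM_sq_pos hn (gegenbauer_ne_zero hn m)
  set B := meanLM hn (gegenbauer n (m + 1) ^ 2)
  set D := meanLM hn (gegenbauer n m ^ 2)
  have hB : B = D * ((m + 1) * (n - 2 + 2 * m)) / ((n - 2 + m) * (n + 2 * m)) := by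
    rw [eq_div_iff (by positivity)]
    exact r0
  have hl := gegLead_pos hn m
  have e : B * (gegLead n (m + 2) * gegLead n m) =
      ((m : ℝ) + 1) / (n - 1 + m) * (D * gegLead n (m + 1) ^ 2) := by
    rw [hB, gegLead_add_two hn, gegLead]
    field_simp
  rw [e, mul_assoc]
  exact mul_lt_mul_of_pos_right (bCoeff_lt hn m)
    (mul_pos hD (pow_pos (gegLead_pos hn (m + 1)) 2))

/-! ### Expansions of the node polynomial -/

lemma nodePoly_succ (n m : ℕ) : nodePoly n (m + 1) =
    gegenbauer n (m + 2) + C (bCoeff n (m + 1)) * gegenbauer n m := rfl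

/-- The polynomial `P_{k+1} + c P_{k-1}` with the negative solution `c`. -/
def conjPoly (n k : ℕ) : ℝ[X] :=
  gegenbauer n (k + 1) + C (cCoeff n k) * gegenbauer n (k - 1)

lemma conjPoly_succ (n m : ℕ) : conjPoly n (m + 1) =
    gegenbauer n (m + 2) + C (cCoeff n (m + 1)) * gegenbauer n m := rfl

lemma gegenbauer_add_C_mul_sub_mem (hn : 3 ≤ n) (m : ℕ) (r : ℝ) :
    gegenbauer n (m + 2) + C r * gegenbauer n m - C (gegLead n (m + 2)) * X ^ (m + 2) -
      C (r * gegLead n m - gegLead n (m + 2) * gegSub n m) * X ^ m ∈ degreeLT ℝ m := by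
  have h1 := gegenbauer_sub_lead_two_mem hn m
  have h2 := C_mul_mem_degreeLT r (mem_degreeLT_mono (b := m) (by omega)
    (gegenbauer_sub_lead_mem hn m))
  convert add_mem h1 h2 using 1
  simp only [C_sub, C_mul]
  ring

lemma gegenbauer_add_C_mul_sub_lead_mem (hn : 3 ≤ n) (m : ℕ) (r : ℝ) :
    gegenbauer n (m + 2) + C r * gegenbauer n m - C (gegLead n (m + 2)) * X ^ (m + 2) ∈
      degreeLT ℝ (m + 1) := by
  have h1 := mem_degreeLT_mono (b := m + 1) (by omega) (gegenbauer_add_C_mul_sub_mem hn m r)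
  have h2 := C_mul_mem_degreeLT (r * gegLead n m - gegLead n (m + 2) * gegSub n m)
    (X_pow_mem_degreeLT (Nat.lt_succ_self m))
  simpa using add_mem h1 h2

lemma nodePoly_sub_lead_mem (hn : 3 ≤ n) (m : ℕ) :
    nodePoly n (m + 1) - C (gegLead n (m + 2)) * X ^ (m + 2) ∈ degreeLT ℝ (m + 1) :=
  gegenbauer_add_C_mul_sub_lead_mem hn m _

lemma nodePoly_mem_degreeLT (hn : 3 ≤ n) (m : ℕ) : nodePoly n (m + 1) ∈ degreeLT ℝ (m + 3) := by
  have h1 := mem_degreeLT_mono (b := m + 3) (by omega) (nodePoly_sub_lead_mem hn m)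
  have h2 := C_mul_mem_degreeLT (gegLead n (m + 2)) (X_pow_mem_degreeLT
    (by omega : m + 2 < m + 3))
  simpa using add_mem h1 h2

lemma coeff_nodePoly (hn : 3 ≤ n) (m : ℕ) :
    (nodePoly n (m + 1)).coeff (m + 2) = gegLead n (m + 2) := by
  have := coeff_eq_zero_of_mem (nodePoly_sub_lead_mem hn m) (by omega : m + 1 ≤ m + 2)
  simpa [sub_eq_zero] using this

lemma natDegree_nodePoly (hn : 3 ≤ n) (m : ℕ) : (nodePoly n (m + 1)).natDegree = m + 2 :=
  natDegree_eq_of_le_of_coeff_ne_zero (mem_degreeLT_succ_iff.1 (nodePoly_mem_degreeLT hn m))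
    (by rw [coeff_nodePoly hn]; exact (gegLead_pos hn _).ne')

lemma nodePoly_ne_zero (hn : 3 ≤ n) (m : ℕ) : nodePoly n (m + 1) ≠ 0 := by
  intro h
  have := natDegree_nodePoly hn m
  simp [h] at this

/-- A missing second coefficient in both factors stays missing in the product. -/
lemma mul_sub_lead_mem {f g : ℝ[X]} {a b : ℕ} {r s : ℝ}
    (hf : f - C r * X ^ (a + 1) ∈ degreeLT ℝ a) (hg : g - C s * X ^ b ∈ degreeLT ℝ (b - 1)) :
    f * g - C (r * s) * X ^ (a + 1 + b) ∈ degreeLT ℝ (a + b) := by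
  have e : f * g - C (r * s) * X ^ (a + 1 + b) =
      (f - C r * X ^ (a + 1)) * (g - C s * X ^ b) + (f - C r * X ^ (a + 1)) * (C s * X ^ b) +
        C r * X ^ (a + 1) * (g - C s * X ^ b) := by
    rw [C_mul]
    ring
  rw [e]
  refine add_mem (add_mem (mul_mem_degreeLT hf hg (by omega)) (mul_mem_degreeLT hf
    (C_mul_mem_degreeLT s (X_pow_mem_degreeLT (Nat.lt_succ_self b))) (by omega))) ?_
  rcases b with _ | b
  · have : g - C s * X ^ 0 = 0 := by
      have h0 := hg
      rw [Nat.zero_sub] at h0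
      ext i
      exact coeff_eq_zero_of_mem h0 (Nat.zero_le i)
    rw [this, mul_zero]
    exact zero_mem _
  · exact mul_mem_degreeLT (C_mul_mem_degreeLT r (X_pow_mem_degreeLT (Nat.lt_succ_self (a + 1))))
      hg (by omega)

lemma nodePoly_mul_gegenbauer_mem (hn : 3 ≤ n) (m i : ℕ) :
    nodePoly n (m + 1) * gegenbauer n i - C (gegLead n (m + 2) * gegLead n i) * X ^ (m + 2 + i) ∈
      degreeLT ℝ (m + 1 + i) :=
  mul_sub_lead_mem (nodePoly_sub_lead_mem hn m) (gegenbauer_sub_lead_mem hn i)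

/-- Beyond matching leading terms, t^{2m+3} is absent by parity and t^{2m+2} cancels by the choice
of b + c. -/
lemma nodePoly_mul_conjPoly_mem (hn : 3 ≤ n) (m : ℕ) :
    nodePoly n (m + 1) * conjPoly n (m + 1) -
      C (gegLead n (m + 2) ^ 2 / gegLead n (2 * m + 4)) * gegenbauer n (2 * m + 4) ∈
      degreeLT ℝ (2 * m + 2) := by
  have hl := gegLead_pos hn (2 * m + 4)
  have hb := gegenbauer_add_C_mul_sub_mem hn m (bCoeff n (m + 1))
  have hc := gegenbauer_add_C_mul_sub_mem hn m (cCoeff n (m + 1))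
  have hp := gegenbauer_sub_lead_two_mem hn (2 * m + 2)
  rw [← nodePoly_succ] at hb
  rw [← conjPoly_succ] at hc
  set l := gegLead n (m + 2)
  set u := bCoeff n (m + 1) * gegLead n m - l * gegSub n m with hu
  set v := cCoeff n (m + 1) * gegLead n m - l * gegSub n m with hv
  -- With u and v the second coefficients of q and r, this is the cancellation at t^{2m+2}.
  have huv : C l * (C u + C v) = -(C (l ^ 2) * C (gegSub n (2 * m + 2))) := by
    rw [← C_add, ← C_mul, ← C_mul, ← C_neg]
    congr 1
    have := bcSum_mul_gegLead hn m
    rw [← bCoeff_add_cCoeff] at this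
    rw [hu, hv]
    linear_combination l * this
  have hl' : C (l ^ 2 / gegLead n (2 * m + 4)) * C (gegLead n (2 * m + 4)) = C (l ^ 2) := by
    rw [← C_mul, div_mul_cancel₀ _ hl.ne']
  set q := nodePoly n (m + 1)
  set r := conjPoly n (m + 1)
  have e : q * r - C (l ^ 2 / gegLead n (2 * m + 4)) * gegenbauer n (2 * m + 4) =
      (q - C l * X ^ (m + 2) - C u * X ^ m) * (C l * X ^ (m + 2) + C v * X ^ m) +
      (C l * X ^ (m + 2) + C u * X ^ m) * (r - C l * X ^ (m + 2) - C v * X ^ m) +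
      (q - C l * X ^ (m + 2) - C u * X ^ m) * (r - C l * X ^ (m + 2) - C v * X ^ m) +
      C (u * v) * X ^ (2 * m) -
      C (l ^ 2 / gegLead n (2 * m + 4)) * (gegenbauer n (2 * m + 2 + 2) -
        C (gegLead n (2 * m + 2 + 2)) *
          (X ^ (2 * m + 2 + 2) - C (gegSub n (2 * m + 2)) * X ^ (2 * m + 2))) := by
    rw [C_mul]
    have : C (l ^ 2) = C l ^ 2 := C_pow
    rw [this] at hl' huv
    linear_combination (-(X ^ (2 * m + 4)) + C (gegSub n (2 * m + 2)) * X ^ (2 * m + 2)) * hl' +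
      X ^ (2 * m + 2) * huv
  have hX : ∀ w : ℝ, C l * X ^ (m + 2) + C w * X ^ m ∈ degreeLT ℝ (m + 3) := fun w =>
    add_mem (C_mul_mem_degreeLT _ (X_pow_mem_degreeLT (by omega)))
      (C_mul_mem_degreeLT _ (X_pow_mem_degreeLT (by omega)))
  rw [e]
  refine sub_mem (add_mem (add_mem (add_mem (mul_mem_degreeLT hb (hX v) (by omega))
    (mul_mem_degreeLT (hX u) hc (by omega))) (mul_mem_degreeLT hb hc (by omega)))
    (C_mul_mem_degreeLT _ (X_pow_mem_degreeLT (by omega)))) (C_mul_mem_degreeLT _ hp)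

lemma meanLM_nodePoly_mul_conjPoly (hn : 3 ≤ n) (m : ℕ) :
    meanLM hn (nodePoly n (m + 1) * conjPoly n (m + 1)) = 0 := by
  have e : nodePoly n (m + 1) * conjPoly n (m + 1) = gegenbauer n (m + 2) ^ 2 +
      C (bcSum n (m + 1)) * (gegenbauer n (m + 2) * gegenbauer n m) +
      C (bcProd n (m + 1)) * gegenbauer n m ^ 2 := by
    rw [nodePoly_succ, conjPoly_succ, ← bCoeff_add_cCoeff, ← bCoeff_mul_cCoeff hn, C_add, C_mul]
    ring
  rw [e, map_add, map_add, map_C_mul, map_C_mul, meanLM_gegenbauer_mul_of_lt hn (by omega),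
    meanLM_sq_add_two hn]
  ring

/-! ### Power series expansion of absolutely monotone functions -/

section Bernstein

open Filter Topology Set

/-- The Taylor remainder at `-1` of order `m` of the `j`-th member of a sequence of functions in
which each function is the derivative of the preceding one. -/
def taylorRem (F : ℕ → ℝ → ℝ) (m j : ℕ) (t : ℝ) : ℝ :=
  F j t - ∑ i ∈ Finset.range m, F (i + j) (-1) / i.factorial * (1 + t) ^ i

variable {F : ℕ → ℝ → ℝ}

lemma taylorRem_zero (j : ℕ) : taylorRem F 0 j = F j := by
  ext t
  simp [taylorRem]

lemma taylorRem_neg_one (m j : ℕ) : taylorRem F (m + 1) j (-1) = 0 := by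
  rw [taylorRem, Finset.sum_range_succ']
  simp

lemma continuousOn_taylorRem (hc : ∀ j, ContinuousOn (F j) (Ico (-1) 1)) (m j : ℕ) :
    ContinuousOn (taylorRem F m j) (Ico (-1) 1) :=
  (hc j).sub (by fun_prop)

/-- At m = 0 the truncated `m - 1` is harmless: the remainder of order zero is the function itself.
-/
lemma hasDerivAt_taylorRem (hd : ∀ j, ∀ t ∈ Ioo (-1 : ℝ) 1, HasDerivAt (F j) (F (j + 1) t) t)
    (m j : ℕ) {t : ℝ} (ht : t ∈ Ioo (-1 : ℝ) 1) :
    HasDerivAt (taylorRem F m j) (taylorRem F (m - 1) (j + 1) t) t := by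
  have h1 : ∀ i : ℕ, HasDerivAt (fun t : ℝ => F (i + j) (-1) / i.factorial * (1 + t) ^ i)
      (F (i + j) (-1) / i.factorial * (i * (1 + t) ^ (i - 1))) t := by
    intro i
    have := (((hasDerivAt_id t).const_add 1).pow i).const_mul (F (i + j) (-1) / i.factorial)
    simpa using this
  have h2 := (hd j t ht).sub (HasDerivAt.fun_sum fun i (_ : i ∈ Finset.range m) => h1 i)
  refine HasDerivAt.congr_deriv (f' := _) h2 ?_
  rw [taylorRem]
  congr 1
  rcases m with _ | m
  · simp
  · rw [Finset.sum_range_succ', Nat.cast_zero, zero_mul, mul_zero, add_zero, Nat.add_sub_cancel]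
    refine Finset.sum_congr rfl fun i _ => ?_
    rw [(by ring : i + 1 + j = i + (j + 1)), Nat.factorial_succ, Nat.add_sub_cancel]
    have : ((i + 1 : ℕ) : ℝ) ≠ 0 := by positivity
    push_cast at this ⊢
    field_simp

lemma monotoneOn_of_hasDerivAt_nonneg {D : Set ℝ} (hD : Convex ℝ D) {f f' : ℝ → ℝ}
    (hf : ContinuousOn f D) (hd : ∀ t ∈ interior D, HasDerivAt f (f' t) t)
    (h0 : ∀ t ∈ interior D, 0 ≤ f' t) : MonotoneOn f D :=
  monotoneOn_of_deriv_nonneg hD hf (fun t ht => (hd t ht).differentiableAt.differentiableWithinAt)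
    fun t ht => (hd t ht).deriv ▸ h0 t ht

variable (hc : ∀ j, ContinuousOn (F j) (Ico (-1) 1))
  (hd : ∀ j, ∀ t ∈ Ioo (-1 : ℝ) 1, HasDerivAt (F j) (F (j + 1) t) t)
  (h0 : ∀ j, ∀ t ∈ Ico (-1 : ℝ) 1, 0 ≤ F j t)

include hc hd h0

/-- A remainder of positive order vanishes at -1, and its derivative is a remainder of lower order,
nonnegative by induction. -/
lemma taylorRem_nonneg (m j : ℕ) : ∀ t ∈ Ico (-1 : ℝ) 1, 0 ≤ taylorRem F m j t := by
  induction m generalizing j with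
  | zero => simpa [taylorRem_zero] using h0 j
  | succ m ih =>
    intro t ht
    have hm : MonotoneOn (taylorRem F (m + 1) j) (Ico (-1) 1) := by
      refine monotoneOn_of_hasDerivAt_nonneg (convex_Ico _ _) (continuousOn_taylorRem hc _ _)
        (f' := taylorRem F m (j + 1)) ?_ ?_
      · rw [interior_Ico]
        exact fun s hs => hasDerivAt_taylorRem hd (m + 1) j hs
      · rw [interior_Ico]
        exact fun s hs => ih (j + 1) s (Ioo_subset_Ico_self hs)
    have := hm (left_mem_Ico.2 (by norm_num)) ht ht.1
    rwa [taylorRem_neg_one] at this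

/-- Up to a positive factor, this is the nonnegativity of the derivative of R_m(t) / (1 + t)^m,
where R_m is the remainder. -/
lemma mul_taylorRem_le (m j : ℕ) : ∀ t ∈ Ico (-1 : ℝ) 1,
    m * taylorRem F m j t ≤ (1 + t) * taylorRem F (m - 1) (j + 1) t := by
  induction m generalizing j with
  | zero =>
    intro t ht
    rw [Nat.cast_zero, zero_mul, taylorRem_zero]
    exact mul_nonneg (by linarith [ht.1]) (h0 _ t ht)
  | succ m ih =>
    intro t ht
    rw [Nat.add_sub_cancel]
    have hm : MonotoneOn (fun t => (1 + t) * taylorRem F m (j + 1) t -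
        ((m + 1 : ℕ) : ℝ) * taylorRem F (m + 1) j t) (Ico (-1) 1) := by
      refine monotoneOn_of_hasDerivAt_nonneg (convex_Ico _ _) ?_
        (f' := fun t => (1 * taylorRem F m (j + 1) t + (1 + t) * taylorRem F (m - 1) (j + 2) t) -
          ((m + 1 : ℕ) : ℝ) * taylorRem F m (j + 1) t) ?_ ?_
      · have h1 := continuousOn_taylorRem hc m (j + 1)
        have h2 := continuousOn_taylorRem hc (m + 1) j
        fun_prop
      · rw [interior_Ico]
        intro s hs
        exact ((((hasDerivAt_id s).const_add 1).mul
          (hasDerivAt_taylorRem hd m (j + 1) hs))).sub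
          ((hasDerivAt_taylorRem hd (m + 1) j hs).const_mul _)
      · rw [interior_Ico]
        intro s hs
        have := ih (j + 1) s (Ioo_subset_Ico_self hs)
        push_cast
        linarith
    have := hm (left_mem_Ico.2 (by norm_num)) ht ht.1
    simp only [taylorRem_neg_one] at this
    linarith

/-- The quotient R_m / (1 + t)^m is nondecreasing and R_m ≤ F, so the remainder decays geometrically
to the left of t. -/
lemma taylorRem_le (m : ℕ) {s t : ℝ} (hs : s ∈ Ioo (-1 : ℝ) 1) (ht : t ∈ Ioo (-1 : ℝ) 1)
    (hst : s ≤ t) : taylorRem F m 0 s ≤ ((1 + s) / (1 + t)) ^ m * F 0 t := by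
  have hs1 : 0 < 1 + s := by linarith [hs.1]
  have ht1 : 0 < 1 + t := by linarith [ht.1]
  have hm : MonotoneOn (fun t => taylorRem F m 0 t / (1 + t) ^ m) (Ioo (-1) 1) := by
    refine monotoneOn_of_hasDerivAt_nonneg (convex_Ioo _ _) ?_
      (f' := fun t => (taylorRem F (m - 1) 1 t * (1 + t) ^ m -
        taylorRem F m 0 t * (m * (1 + t) ^ (m - 1) * 1)) / ((1 + t) ^ m) ^ 2) ?_ ?_
    · refine ((continuousOn_taylorRem hc m 0).mono Ioo_subset_Ico_self).div (by fun_prop) ?_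
      intro u hu
      have : 0 < 1 + u := by linarith [hu.1]
      positivity
    · rw [interior_Ioo]
      intro u hu
      have : 0 < 1 + u := by linarith [hu.1]
      exact (hasDerivAt_taylorRem hd m 0 hu).div (((hasDerivAt_id u).const_add 1).pow m)
        (pow_pos this m).ne'
    · rw [interior_Ioo]
      intro u hu
      have hu1 : 0 < 1 + u := by linarith [hu.1]
      refine div_nonneg ?_ (by positivity)
      have h := mul_taylorRem_le hc hd h0 m 0 u (Ioo_subset_Ico_self hu)
      rcases m with _ | m
      · have := h0 1 u (Ioo_subset_Ico_self hu)
        simpa [taylorRem_zero] using this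
      · rw [Nat.add_sub_cancel, zero_add] at *
        have := mul_le_mul_of_nonneg_right h (pow_nonneg hu1.le m)
        rw [pow_succ]
        linarith
  have h := hm hs ht hst
  have hle : taylorRem F m 0 t ≤ F 0 t := by
    rw [taylorRem, sub_le_self_iff]
    refine Finset.sum_nonneg fun i _ => mul_nonneg (div_nonneg (h0 _ _ ?_) (by positivity))
      (by positivity)
    exact left_mem_Ico.2 (by norm_num)
  rw [div_pow, div_mul_eq_mul_div, le_div_iff₀ (by positivity)]
  simp only at h
  rw [div_le_div_iff₀ (by positivity) (by positivity)] at h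
  nlinarith [pow_pos hs1 m]

lemma hasSum_of_nonneg_derivatives {t : ℝ} (ht : t ∈ Ico (-1 : ℝ) 1) :
    HasSum (fun j => F j (-1) / j.factorial * (1 + t) ^ j) (F 0 t) := by
  have hl : (-1 : ℝ) ∈ Ico (-1 : ℝ) 1 := left_mem_Ico.2 (by norm_num)
  rcases ht.1.eq_or_lt with rfl | ht0
  · convert hasSum_single (0 : ℕ) ?_ using 1
    · simp
    · intro j hj
      simp [hj]
  have ht1 : 0 < 1 + t := by linarith
  rw [hasSum_iff_tendsto_nat_of_nonneg (fun j => mul_nonneg (div_nonneg (h0 j _ hl)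
    (by positivity)) (by positivity))]
  obtain ⟨T, hT, hT1⟩ := exists_between ht.2
  have hTm : T ∈ Ioo (-1 : ℝ) 1 := ⟨by linarith, hT1⟩
  have hT0 : 0 < 1 + T := by linarith
  have hlim : Tendsto (fun m : ℕ => ((1 + t) / (1 + T)) ^ m * F 0 T) atTop (𝓝 0) := by
    rw [← zero_mul (F 0 T)]
    exact (tendsto_pow_atTop_nhds_zero_of_lt_one (by positivity)
      (by rw [div_lt_one hT0]; linarith)).mul_const _
  have hR : Tendsto (fun m : ℕ => taylorRem F m 0 t) atTop (𝓝 0) :=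
    squeeze_zero (fun m => taylorRem_nonneg hc hd h0 m 0 t ht)
      (fun m => taylorRem_le hc hd h0 m ⟨ht0, ht.2⟩ hTm hT.le) hlim
  have := hR.const_sub (F 0 t)
  rw [sub_zero] at this
  refine this.congr fun m => ?_
  simp [taylorRem]

omit hc hd h0

/-- Bernstein's theorem: an absolutely monotone function on `(-1, 1)` that is continuous at `-1`
has a power series expansion at `-1` with nonnegative coefficients. -/
theorem hasSum_of_absolutelyMonotoneOn {f : ℝ → ℝ} (hf : AbsolutelyMonotoneOn f (Ioo (-1) 1))
    (hfc : ContinuousOn f (Ico (-1) 1)) :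
    ∃ a : ℕ → ℝ, (∀ j, 0 ≤ a j) ∧
      ∀ t ∈ Ico (-1 : ℝ) 1, HasSum (fun j => a j * (1 + t) ^ j) (f t) := by
  have hl : (-1 : ℝ) ∈ Ico (-1 : ℝ) 1 := left_mem_Ico.2 (by norm_num)
  have hu : UniqueDiffOn ℝ (Ioo (-1 : ℝ) 1) := isOpen_Ioo.uniqueDiffOn
  set G : ℕ → ℝ → ℝ := fun j => iteratedDerivWithin j f (Ioo (-1) 1) with hG
  have hG0 : ∀ j, ∀ t ∈ Ioo (-1 : ℝ) 1, 0 ≤ G j t := fun j t ht =>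
    hf.iteratedDerivWithin_nonneg hu j ht
  have hGd : ∀ j, ∀ t ∈ Ioo (-1 : ℝ) 1, HasDerivAt (G j) (G (j + 1) t) t := by
    intro j t ht
    have h1 := (hf.contDiffOn.differentiableOn_iteratedDerivWithin (m := j)
      (by exact_mod_cast ENat.natCast_lt_top j) hu) t ht
    have h2 := h1.hasDerivWithinAt.hasDerivAt (isOpen_Ioo.mem_nhds ht)
    have h3 : G (j + 1) t = derivWithin (G j) (Ioo (-1) 1) t :=
      congrFun iteratedDerivWithin_succ t
    rwa [h3]
  have hGm : ∀ j, MonotoneOn (G j) (Ioo (-1) 1) := fun j =>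
    monotoneOn_of_hasDerivAt_nonneg (convex_Ioo _ _)
      (fun t ht => (hGd j t ht).continuousAt.continuousWithinAt)
      (by rw [interior_Ioo]; exact hGd j) (by rw [interior_Ioo]; exact hG0 (j + 1))
  have hGl : ∀ j, Tendsto (G j) (𝓝[>] (-1)) (𝓝 (sInf (G j '' Ioo (-1) 1))) := fun j =>
    (hGm j).tendsto_nhdsWithin_Ioo_right (nonempty_Ioo.2 (by norm_num))
      ⟨0, by rintro _ ⟨t, ht, rfl⟩; exact hG0 j t ht⟩
  -- The derivatives live on the open interval. Each is nondecreasing and bounded below, so its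
  -- infimum is its right limit at -1 and is taken as its value there.
  set F : ℕ → ℝ → ℝ := fun j => Function.update (G j) (-1) (sInf (G j '' Ioo (-1) 1)) with hF
  have hFG : ∀ j, ∀ t ∈ Ioo (-1 : ℝ) 1, F j =ᶠ[𝓝 t] G j := by
    intro j t ht
    filter_upwards [isOpen_Ioo.mem_nhds ht] with s hs
    rw [hF]
    exact Function.update_of_ne hs.1.ne' _ _
  have hF1 : ∀ j, F j (-1) = sInf (G j '' Ioo (-1) 1) := fun j => Function.update_self _ _ _
  have hFd : ∀ j, ∀ t ∈ Ioo (-1 : ℝ) 1, HasDerivAt (F j) (F (j + 1) t) t := by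
    intro j t ht
    rw [(hFG (j + 1) t ht).eq_of_nhds]
    exact (hGd j t ht).congr_of_eventuallyEq (hFG j t ht)
  have hFl : ∀ j, Tendsto (F j) (𝓝[>] (-1)) (𝓝 (F j (-1))) := by
    intro j
    rw [hF1]
    refine (hGl j).congr' ?_
    filter_upwards [self_mem_nhdsWithin] with s hs
    rw [hF]
    exact (Function.update_of_ne (ne_of_gt hs) _ _).symm
  have hFc : ∀ j, ContinuousOn (F j) (Ico (-1) 1) := by
    intro j t ht
    rcases ht.1.eq_or_lt with rfl | h
    · have h := continuousWithinAt_Ioi_iff_Ici.1 (hFl j)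
      exact h.mono Ico_subset_Ici_self
    · exact (hFd j t ⟨h, ht.2⟩).continuousAt.continuousWithinAt
  have hF0 : ∀ j, ∀ t ∈ Ico (-1 : ℝ) 1, 0 ≤ F j t := by
    intro j t ht
    rcases ht.1.eq_or_lt with rfl | h
    · rw [hF1]
      exact Real.sInf_nonneg (by rintro _ ⟨s, hs, rfl⟩; exact hG0 j s hs)
    · rw [(hFG j t ⟨h, ht.2⟩).eq_of_nhds]
      exact hG0 j t ⟨h, ht.2⟩
  have hFf : ∀ t ∈ Ico (-1 : ℝ) 1, F 0 t = f t := by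
    intro t ht
    have hG0f : G 0 = f := by rw [hG]; exact iteratedDerivWithin_zero
    rcases ht.1.eq_or_lt with rfl | h
    · refine tendsto_nhds_unique (hFl 0) ?_
      have h1 : Tendsto f (𝓝[>] (-1)) (𝓝 (f (-1))) :=
        ((hfc (-1) hl).mono Ioo_subset_Ico_self).tendsto.mono_left
          (by rw [nhdsWithin_Ioo_eq_nhdsGT (by norm_num)])
      refine h1.congr' ?_
      filter_upwards [self_mem_nhdsWithin] with s hs
      rw [hF]
      simp only [hG0f]
      exact (Function.update_of_ne (ne_of_gt hs) _ _).symm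
    · rw [(hFG 0 t ⟨h, ht.2⟩).eq_of_nhds, hG0f]
  refine ⟨fun j => F j (-1) / j.factorial, fun j => div_nonneg (hF0 j _ hl) (by positivity),
    fun t ht => ?_⟩
  rw [← hFf t ht]
  exact hasSum_of_nonneg_derivatives hFc hFd hF0 ht

end Bernstein

/-! ### Nodes and weights -/

/-- The functional that agrees with the mean on polynomials of degree `≤ 2k - 1`, and with the
quadrature at the roots of `q_{k+1}` on polynomials of degree `≤ 2k`, where `k = m + 1`. -/
def nodeLM (hn : 3 ≤ n) (m : ℕ) : ℝ[X] →ₗ[ℝ] ℝ :=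
  meanLM hn - (bCoeff n (m + 1) * meanLM hn (gegenbauer n m ^ 2) /
    (gegLead n (m + 2) * gegLead n m)) • lcoeff ℝ (2 * m + 2)

lemma nodeLM_apply (hn : 3 ≤ n) (m : ℕ) (f : ℝ[X]) :
    nodeLM hn m f = meanLM hn f - bCoeff n (m + 1) * meanLM hn (gegenbauer n m ^ 2) /
      (gegLead n (m + 2) * gegLead n m) * f.coeff (2 * m + 2) := rfl

lemma nodeLM_eq_meanLM (hn : 3 ≤ n) {m : ℕ} {f : ℝ[X]} (hf : f ∈ degreeLT ℝ (2 * m + 2)) :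
    nodeLM hn m f = meanLM hn f := by
  rw [nodeLM_apply, coeff_eq_zero_of_mem hf le_rfl, mul_zero, sub_zero]

/-- Orthogonality handles P_i with i < m. At i = m the mean equals b ∫ P_m² dμ, and δ is chosen so
that the t^{2m+2} coefficient cancels it. -/
lemma nodeLM_nodePoly_mul (hn : 3 ≤ n) {m : ℕ} {g : ℝ[X]} (hg : g ∈ degreeLT ℝ (m + 1)) :
    nodeLM hn m (nodePoly n (m + 1) * g) = 0 := by
  refine eq_zero_of_mem_degreeLT hn (nodeLM hn m ∘ₗ LinearMap.mulLeft ℝ (nodePoly n (m + 1)))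
    (fun i hi => ?_) hg
  rw [LinearMap.comp_apply, LinearMap.mulLeft_apply, nodeLM_apply]
  have hL : meanLM hn (nodePoly n (m + 1) * gegenbauer n i) =
      bCoeff n (m + 1) * meanLM hn (gegenbauer n m * gegenbauer n i) := by
    rw [nodePoly_succ, add_mul, mul_assoc, map_add, map_C_mul,
      meanLM_gegenbauer_mul_of_lt hn (by omega), zero_add]
  have hc := coeff_eq_zero_of_mem (nodePoly_mul_gegenbauer_mem hn m i)
    (by omega : m + 1 + i ≤ 2 * m + 2)
  rw [coeff_sub, sub_eq_zero] at hc
  rw [hL, hc]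
  rcases (Nat.lt_succ_iff.1 hi).eq_or_lt with rfl | hi
  · have h1 := (gegLead_pos hn (i + 2)).ne'
    have h2 := (gegLead_pos hn i).ne'
    rw [(by ring : i + 2 + i = 2 * i + 2), coeff_C_mul_X_pow, if_pos rfl, sq]
    field_simp
    ring
  · rw [meanLM_gegenbauer_mul_of_lt hn hi, coeff_C_mul_X_pow, if_neg (by omega)]
    ring

/-- Splitting f into its P_{m+1} component and a lower part g, only the first feels the correction
δ, and there `bCoeff_mul_lt` leaves a positive amount. -/
lemma nodeLM_sq_pos (hn : 3 ≤ n) {m : ℕ} {f : ℝ[X]} (hf : f ∈ degreeLT ℝ (m + 2)) (h0 : f ≠ 0) :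
    0 < nodeLM hn m (f ^ 2) := by
  have hl := gegLead_pos hn (m + 1)
  have hl2 := gegLead_pos hn (m + 2)
  have hl0 := gegLead_pos hn m
  have hcoeff : (f ^ 2).coeff (2 * m + 2) = f.coeff (m + 1) ^ 2 := by
    rw [(by ring : 2 * m + 2 = 2 * (m + 1)),
      coeff_pow_of_natDegree_le (mem_degreeLT_succ_iff.1 hf)]
  set c := f.coeff (m + 1) / gegLead n (m + 1) with hc
  set g := f - C c * gegenbauer n (m + 1) with hg
  have hgm : g ∈ degreeLT ℝ (m + 1) := sub_C_mul_gegenbauer_mem hn hf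
  have hfc : f.coeff (m + 1) = c * gegLead n (m + 1) := by
    rw [hc, div_mul_cancel₀ _ hl.ne']
  have e : f ^ 2 = C (c ^ 2) * gegenbauer n (m + 1) ^ 2 +
      C (2 * c) * (gegenbauer n (m + 1) * g) + g ^ 2 := by
    rw [hg, C_mul, C_pow, map_ofNat]
    ring
  have hL : meanLM hn (f ^ 2) =
      c ^ 2 * meanLM hn (gegenbauer n (m + 1) ^ 2) + meanLM hn (g ^ 2) := by
    rw [e, map_add, map_add, map_C_mul, map_C_mul, meanLM_gegenbauer_mul_of_mem hn hgm]
    ring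
  rw [nodeLM_apply, hcoeff, hL, hfc]
  have hb := bCoeff_mul_lt hn m
  set B := meanLM hn (gegenbauer n (m + 1) ^ 2)
  set D := meanLM hn (gegenbauer n m ^ 2)
  have hpos : 0 < B - bCoeff n (m + 1) * D / (gegLead n (m + 2) * gegLead n m) *
      gegLead n (m + 1) ^ 2 := by
    rw [sub_pos, div_mul_eq_mul_div, div_lt_iff₀ (by positivity)]
    exact hb
  have e2 : c ^ 2 * B + meanLM hn (g ^ 2) -
      bCoeff n (m + 1) * D / (gegLead n (m + 2) * gegLead n m) * (c * gegLead n (m + 1)) ^ 2 =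
      c ^ 2 * (B - bCoeff n (m + 1) * D / (gegLead n (m + 2) * gegLead n m) *
      gegLead n (m + 1) ^ 2) + meanLM hn (g ^ 2) := by ring
  rw [e2]
  by_cases hc0 : c = 0
  · have : g ≠ 0 := by
      rw [hg, hc0]
      simpa using h0
    rw [hc0]
    simpa using meanLM_sq_pos hn this
  · have h1 : 0 < c ^ 2 := by positivity
    have h2 : 0 ≤ meanLM hn (g ^ 2) := by
      by_cases hg0 : g = 0
      · simp [hg0]
      · exact (meanLM_sq_pos hn hg0).le
    have := mul_pos h1 hpos
    linarith

lemma mem_degreeLT_of_mul_eq {f g h : ℝ[X]} {a d : ℕ} (hfg : f = g * h) (hf0 : f ≠ 0)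
    (hf : f.natDegree = a + d) (hg : g.natDegree = a) : h ∈ degreeLT ℝ (d + 1) := by
  rw [mem_degreeLT_succ_iff]
  rw [hfg, natDegree_mul (left_ne_zero_of_mul (hfg ▸ hf0)) (right_ne_zero_of_mul (hfg ▸ hf0)),
    hg] at hf
  omega

/-- If q = ((t - a)² + s) g, then 0 = Λ(q g) = Λ(((t - a) g)²) + s Λ(g²) > 0. The case s > 0
excludes nonreal roots, and s = 0 excludes multiple ones. -/
lemma nodeLM_nonneg_quadratic_not_dvd (hn : 3 ≤ n) (m : ℕ) (a s : ℝ) (hs : 0 ≤ s) :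
    ¬ (X - C a) ^ 2 + C s ∣ nodePoly n (m + 1) := by
  rintro ⟨g, hg⟩
  have hq0 := nodePoly_ne_zero hn m
  have hg0 : g ≠ 0 := right_ne_zero_of_mul (hg ▸ hq0)
  have hd : ((X - C a) ^ 2 + C s : ℝ[X]).natDegree = 2 := by
    rw [natDegree_add_C, natDegree_pow, natDegree_X_sub_C]
  have hgm : g ∈ degreeLT ℝ (m + 1) := mem_degreeLT_of_mul_eq hg hq0
    (by rw [natDegree_nodePoly hn, add_comm]) hd
  have hX : (X - C a : ℝ[X]) ∈ degreeLT ℝ 2 :=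
    sub_mem X_mem_degreeLT (C_mem_degreeLT a (by norm_num))
  have h1 := nodeLM_nodePoly_mul hn hgm
  have e : nodePoly n (m + 1) * g = ((X - C a) * g) ^ 2 + C s * g ^ 2 := by
    rw [hg]
    ring
  rw [e, map_add, map_C_mul] at h1
  have h2 := nodeLM_sq_pos hn (m := m) (mul_mem_degreeLT hX hgm (by omega) : (X - C a) * g ∈ _)
    (mul_ne_zero (X_sub_C_ne_zero a) hg0)
  have h3 := nodeLM_sq_pos hn (m := m) (mem_degreeLT_mono (by omega) hgm) hg0
  nlinarith [mul_nonneg hs h3.le]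

lemma card_roots_nodePoly (hn : 3 ≤ n) (m : ℕ) :
    Multiset.card (nodePoly n (m + 1)).roots = m + 2 := by
  obtain ⟨r, hr, hd, hr0⟩ := exists_prod_multiset_X_sub_C_mul (nodePoly n (m + 1))
  rw [natDegree_nodePoly hn] at hd
  by_contra hne
  have hr1 : r ≠ 0 := by
    rintro rfl
    exact nodePoly_ne_zero hn m (by rw [← hr, mul_zero])
  have hdeg : 0 < (r.map (algebraMap ℝ ℂ)).degree := by
    rw [degree_map, ← natDegree_pos_iff_degree_pos]
    omega
  -- A nonconstant cofactor without real roots has a nonreal root z, so q would be divisible by (X -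
  -- Re z)² + (Im z)².
  obtain ⟨z, hz⟩ := Complex.exists_root hdeg
  have hz' : aeval z r = 0 := by rwa [IsRoot, eval_map_algebraMap] at hz
  by_cases him : z.im = 0
  · have hzr : z = algebraMap ℝ ℂ z.re := by
      rw [Complex.coe_algebraMap]
      exact Complex.ext (by simp) (by simpa using him)
    rw [hzr, aeval_algebraMap_apply, Complex.coe_algebraMap, Complex.ofReal_eq_zero] at hz'
    have : z.re ∈ r.roots := (mem_roots hr1).2 (by simpa using hz')
    rw [hr0] at this
    simp at this
  · have h1 := quadratic_dvd_of_aeval_eq_zero_im_ne_zero r hz' him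
    refine nodeLM_nonneg_quadratic_not_dvd hn m z.re (z.im ^ 2) (sq_nonneg _)
      (dvd_trans ?_ (hr ▸ dvd_mul_left r _))
    convert h1 using 1
    rw [Complex.sq_norm, Complex.normSq_apply]
    simp only [C_add, C_mul, C_pow, map_ofNat]
    ring

lemma nodup_roots_nodePoly (hn : 3 ≤ n) (m : ℕ) : (nodePoly n (m + 1)).roots.Nodup := by
  rw [Multiset.nodup_iff_count_le_one]
  intro a
  rw [count_roots]
  by_contra! h
  have := (le_rootMultiplicity_iff (nodePoly_ne_zero hn m)).1 h
  exact nodeLM_nonneg_quadratic_not_dvd hn m a 0 le_rfl (by simpa using this)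

lemma card_nodes (hn : 3 ≤ n) (m : ℕ) : (nodes n (m + 1)).card = m + 2 := by
  rw [nodes, Multiset.toFinset_card_of_nodup (nodup_roots_nodePoly hn m), card_roots_nodePoly hn]

lemma mem_nodes_iff (hn : 3 ≤ n) (m : ℕ) {r : ℝ} :
    r ∈ nodes n (m + 1) ↔ (nodePoly n (m + 1)).eval r = 0 := by
  rw [nodes, Multiset.mem_toFinset, mem_roots (nodePoly_ne_zero hn m), IsRoot]

/-! ### Symmetry and location of the nodes -/

lemma eval_neg_gegenbauer (n i : ℕ) (t : ℝ) :
    (gegenbauer n i).eval (-t) = (-1) ^ i * (gegenbauer n i).eval t := by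
  induction i using Nat.twoStepInduction with
  | zero => simp [gegenbauer]
  | one => simp [gegenbauer]
  | more i ih0 ih1 =>
    rw [gegenbauer]
    simp only [eval_mul, eval_sub, eval_C, eval_X, ih0, ih1]
    ring

lemma neg_mem_nodes (hn : 3 ≤ n) (m : ℕ) {r : ℝ} (hr : r ∈ nodes n (m + 1)) :
    -r ∈ nodes n (m + 1) := by
  rw [mem_nodes_iff hn] at *
  rw [nodePoly_succ, eval_add, eval_mul, eval_C] at *
  rw [eval_neg_gegenbauer, eval_neg_gegenbauer]
  linear_combination (-1) ^ m * hr

/-- A root r with |r| ≥ 1 gives q = (t² - r²) g by symmetry. Then q g ≤ 0 on (-1, 1) has negative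
mean, while its t^{2m+2} coefficient is a square, so Λ(q g) < 0, contradicting Λ(q g) = 0. -/
lemma nodes_subset (hn : 3 ≤ n) (m : ℕ) {r : ℝ} (hr : r ∈ nodes n (m + 1)) :
    r ∈ Set.Ioo (-1 : ℝ) 1 := by
  rw [Set.mem_Ioo, ← abs_lt, ← sq_lt_one_iff_abs_lt_one]
  by_contra! h1
  have hr0 : r ≠ 0 := by
    rintro rfl
    norm_num at h1
  have hq0 := nodePoly_ne_zero hn m
  have hd1 : X - C r ∣ nodePoly n (m + 1) := dvd_iff_isRoot.2 ((mem_nodes_iff hn m).1 hr)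
  have hd2 : X - C (-r) ∣ nodePoly n (m + 1) :=
    dvd_iff_isRoot.2 ((mem_nodes_iff hn m).1 (neg_mem_nodes hn m hr))
  have hcop : IsCoprime (X - C r) (X - C (-r)) :=
    isCoprime_X_sub_C_of_isUnit_sub (IsUnit.mk0 _ (by
      intro h
      exact hr0 (by linarith)))
  obtain ⟨g, hg⟩ := hcop.mul_dvd hd1 hd2
  have e0 : (X - C r) * (X - C (-r)) = X ^ 2 - C (r ^ 2) := by
    rw [C_neg, C_pow]
    ring
  rw [e0] at hg
  have hg0 : g ≠ 0 := right_ne_zero_of_mul (hg ▸ hq0)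
  have hgm : g ∈ degreeLT ℝ (m + 1) := mem_degreeLT_of_mul_eq hg hq0
    (by rw [natDegree_nodePoly hn, add_comm]) natDegree_X_pow_sub_C
  have hΛ := nodeLM_nodePoly_mul hn hgm
  have e : nodePoly n (m + 1) * g = (X * g) ^ 2 - C (r ^ 2) * g ^ 2 := by
    rw [hg]
    ring
  have hXg : X * g ∈ degreeLT ℝ (m + 2) := mul_mem_degreeLT X_mem_degreeLT hgm (by omega)
  have hc1 : ((X * g) ^ 2).coeff (2 * m + 2) = (X * g).coeff (m + 1) ^ 2 := by
    rw [(by ring : 2 * m + 2 = 2 * (m + 1)),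
      coeff_pow_of_natDegree_le (mem_degreeLT_succ_iff.1 hXg)]
  have hg2 : g ^ 2 ∈ degreeLT ℝ (2 * m + 2) := by
    rw [sq]
    exact mul_mem_degreeLT hgm hgm (by omega)
  have hc : (nodePoly n (m + 1) * g).coeff (2 * m + 2) = (X * g).coeff (m + 1) ^ 2 := by
    rw [e, coeff_sub, hc1, coeff_C_mul, coeff_eq_zero_of_mem hg2 le_rfl, mul_zero, sub_zero]
  have hmean : 0 < meanLM hn (-(nodePoly n (m + 1) * g)) := by
    refine meanLM_pos hn (neg_ne_zero.2 (mul_ne_zero hq0 hg0)) fun t ht => ?_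
    rw [e]
    simp only [eval_neg, eval_sub, eval_mul, eval_pow, eval_X, eval_C]
    have h2 : t ^ 2 ≤ 1 := by nlinarith [ht.1, ht.2]
    nlinarith [mul_nonneg (by linarith : 0 ≤ r ^ 2 - t ^ 2) (sq_nonneg (g.eval t))]
  rw [nodeLM_apply, hc] at hΛ
  rw [map_neg] at hmean
  have hδ : 0 < bCoeff n (m + 1) * meanLM hn (gegenbauer n m ^ 2) /
      (gegLead n (m + 2) * gegLead n m) :=
    div_pos (mul_pos (bCoeff_pos hn m) (meanLM_sq_pos hn (gegenbauer_ne_zero hn m)))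
      (mul_pos (gegLead_pos hn _) (gegLead_pos hn _))
  nlinarith [mul_nonneg hδ.le (sq_nonneg ((X * g).coeff (m + 1)))]

lemma exists_pos_node (hn : 3 ≤ n) (m : ℕ) : ∃ r ∈ nodes n (m + 1), 0 < r := by
  obtain ⟨r, hr, s, hs, hrs⟩ := Finset.one_lt_card.1
    (by rw [card_nodes hn]; omega : 1 < (nodes n (m + 1)).card)
  by_contra! h
  have h1 := h r hr
  have h2 := h s hs
  have h3 := h _ (neg_mem_nodes hn m hr)
  have h4 := h _ (neg_mem_nodes hn m hs)
  exact hrs (by linarith)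

/-- The quadrature at the nodes, as a linear functional. -/
def quadLM (n m : ℕ) : ℝ[X] →ₗ[ℝ] ℝ :=
  ∑ β ∈ nodes n (m + 1), nodeWeight n (m + 1) β • leval β

lemma quadLM_apply (n m : ℕ) (f : ℝ[X]) :
    quadLM n m f = ∑ β ∈ nodes n (m + 1), nodeWeight n (m + 1) β * f.eval β := by
  simp [quadLM, LinearMap.sum_apply]

lemma nodeWeight_eq (hn : 3 ≤ n) (m : ℕ) (β : ℝ) :
    nodeWeight n (m + 1) β = meanLM hn (Lagrange.basis (nodes n (m + 1)) id β) := rfl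

lemma basis_mem_degreeLT (hn : 3 ≤ n) (m : ℕ) {β : ℝ} (hβ : β ∈ nodes n (m + 1)) :
    Lagrange.basis (nodes n (m + 1)) id β ∈ degreeLT ℝ (m + 2) := by
  rw [mem_degreeLT_succ_iff, Lagrange.natDegree_basis Function.injective_id.injOn hβ, card_nodes hn]
  omega

lemma eq_sum_basis (hn : 3 ≤ n) {m : ℕ} {f : ℝ[X]} (hf : f ∈ degreeLT ℝ (m + 2)) :
    f = ∑ β ∈ nodes n (m + 1), C (f.eval β) * Lagrange.basis (nodes n (m + 1)) id β := by
  have := Lagrange.eq_interpolate (s := nodes n (m + 1)) (v := id) (f := f)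
    Function.injective_id.injOn (by rw [card_nodes hn]; exact mem_degreeLT.1 hf)
  rwa [Lagrange.interpolate_apply] at this

lemma quadLM_nodePoly_mul (hn : 3 ≤ n) (m : ℕ) (g : ℝ[X]) :
    quadLM n m (nodePoly n (m + 1) * g) = 0 := by
  rw [quadLM_apply]
  refine Finset.sum_eq_zero fun β hβ => ?_
  rw [eval_mul, (mem_nodes_iff hn m).1 hβ, zero_mul, mul_zero]

/-- Gauss's argument: after division by q, both functionals kill the multiple of q, and Lagrange
interpolation handles the remainder. -/
lemma quadLM_eq_nodeLM (hn : 3 ≤ n) {m : ℕ} {f : ℝ[X]} (hf : f ∈ degreeLT ℝ (2 * m + 3)) :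
    quadLM n m f = nodeLM hn m f := by
  have hq0 := nodePoly_ne_zero hn m
  have hdq := natDegree_nodePoly hn m
  have hr : f % nodePoly n (m + 1) ∈ degreeLT ℝ (m + 2) := by
    rw [mem_degreeLT]
    have := degree_mod_lt f hq0
    rwa [degree_eq_natDegree hq0, hdq] at this
  have hg : f / nodePoly n (m + 1) ∈ degreeLT ℝ (m + 1) := by
    by_cases h0 : f / nodePoly n (m + 1) = 0
    · rw [h0]
      exact zero_mem _
    have h1 := sub_mem hf (mem_degreeLT_mono (b := 2 * m + 3) (by omega) hr)
    rw [← eq_sub_of_add_eq (EuclideanDomain.div_add_mod f (nodePoly n (m + 1))),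
      mem_degreeLT_succ_iff, natDegree_mul hq0 h0, hdq] at h1
    rw [mem_degreeLT_succ_iff]
    omega
  have h1 : quadLM n m (f % nodePoly n (m + 1)) = nodeLM hn m (f % nodePoly n (m + 1)) := by
    rw [nodeLM_eq_meanLM hn (mem_degreeLT_mono (by omega) hr), quadLM_apply]
    conv_rhs => rw [eq_sum_basis hn hr, map_sum]
    refine Finset.sum_congr rfl fun β _ => ?_
    rw [map_C_mul, nodeWeight_eq hn, mul_comm]
  conv_lhs => rw [← EuclideanDomain.div_add_mod f (nodePoly n (m + 1))]
  conv_rhs => rw [← EuclideanDomain.div_add_mod f (nodePoly n (m + 1))]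
  rw [map_add, map_add, quadLM_nodePoly_mul hn, nodeLM_nodePoly_mul hn hg, h1]

lemma quadLM_eq_meanLM (hn : 3 ≤ n) {m : ℕ} {f : ℝ[X]} (hf : f ∈ degreeLT ℝ (2 * m + 2)) :
    quadLM n m f = meanLM hn f := by
  rw [quadLM_eq_nodeLM hn (mem_degreeLT_mono (by omega) hf), nodeLM_eq_meanLM hn hf]

/-- The weight equals Λ(L²) for the Lagrange basis polynomial L; L² has degree 2m + 2, the last
degree where quadrature and Λ agree. -/
lemma nodeWeight_pos (hn : 3 ≤ n) (m : ℕ) {β : ℝ} (hβ : β ∈ nodes n (m + 1)) :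
    0 < nodeWeight n (m + 1) β := by
  have hB := basis_mem_degreeLT hn m hβ
  have h0 : Lagrange.basis (nodes n (m + 1)) id β ≠ 0 :=
    Lagrange.basis_ne_zero Function.injective_id.injOn hβ
  have h1 := nodeLM_sq_pos hn hB h0
  rw [← quadLM_eq_nodeLM hn (by rw [sq]; exact mul_mem_degreeLT hB hB (by omega)),
    quadLM_apply, Finset.sum_eq_single β] at h1
  · have hs : (Lagrange.basis (nodes n (m + 1)) id β).eval β = 1 :=
      Lagrange.eval_basis_self (v := id) Function.injective_id.injOn hβ
    rwa [eval_pow, hs, one_pow, mul_one] at h1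
  · intro γ hγ hne
    have hs : (Lagrange.basis (nodes n (m + 1)) id β).eval γ = 0 :=
      Lagrange.eval_basis_of_ne (v := id) hne.symm hγ
    rw [eval_pow, hs]
    ring
  · exact fun h => absurd hβ h

/-- Up to degree ≤ 2m + 1, P_{2m+3} is a multiple of q P_{m+1}, which vanishes at the nodes and has
mean zero. -/
lemma quadLM_gegenbauer_odd (hn : 3 ≤ n) (m : ℕ) : quadLM n m (gegenbauer n (2 * m + 3)) = 0 := by
  have h1 := nodePoly_mul_gegenbauer_mem hn m (m + 1)
  have h2 := gegenbauer_sub_lead_mem hn (2 * m + 3)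
  have hl := (gegLead_pos hn (2 * m + 3)).ne'
  set A := gegLead n (m + 2) * gegLead n (m + 1) with hA
  have hA0 : A / gegLead n (2 * m + 3) ≠ 0 :=
    div_ne_zero (mul_pos (gegLead_pos hn _) (gegLead_pos hn _)).ne' hl
  have hm : nodePoly n (m + 1) * gegenbauer n (m + 1) -
      C (A / gegLead n (2 * m + 3)) * gegenbauer n (2 * m + 3) ∈ degreeLT ℝ (2 * m + 2) := by
    have h3 := C_mul_mem_degreeLT (A / gegLead n (2 * m + 3))
      (mem_degreeLT_mono (b := 2 * m + 2) (by omega) h2)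
    convert sub_mem (mem_degreeLT_mono (b := 2 * m + 2) (by omega) h1) h3 using 1
    rw [mul_sub, ← mul_assoc (C _), ← C_mul, div_mul_cancel₀ _ hl,
      (by ring : m + 2 + (m + 1) = 2 * m + 3)]
    ring
  have h4 := quadLM_eq_meanLM hn hm
  have h5 : meanLM hn (nodePoly n (m + 1) * gegenbauer n (m + 1)) = 0 := by
    rw [nodePoly_succ, add_mul, mul_assoc, map_add, map_C_mul,
      meanLM_gegenbauer_mul_of_lt hn (by omega), mul_comm (gegenbauer n m),
      meanLM_gegenbauer_mul_of_lt hn (by omega)]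
    ring
  rw [map_sub, map_sub, map_C_mul, map_C_mul, quadLM_nodePoly_mul hn, h5,
    meanLM_gegenbauer hn] at h4
  simpa [hA0] using h4

/-- The same argument with q r; here both conditions on b and c are used. -/
lemma quadLM_gegenbauer_even (hn : 3 ≤ n) (m : ℕ) :
    quadLM n m (gegenbauer n (2 * m + 4)) = 0 := by
  have h1 := quadLM_eq_meanLM hn (nodePoly_mul_conjPoly_mem hn m)
  have hA0 : gegLead n (m + 2) ^ 2 / gegLead n (2 * m + 4) ≠ 0 :=
    div_ne_zero (pow_ne_zero 2 (gegLead_pos hn _).ne') (gegLead_pos hn _).ne'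
  rw [map_sub, map_sub, map_C_mul, map_C_mul, quadLM_nodePoly_mul hn,
    meanLM_nodePoly_mul_conjPoly hn, meanLM_gegenbauer hn] at h1
  simpa [hA0] using h1

lemma mem_indexSet_succ {m i : ℕ} (h : i ∈ indexSet (m + 1)) :
    1 ≤ i ∧ (i < 2 * m + 2 ∨ i = 2 * m + 3 ∨ i = 2 * m + 4) := by
  obtain ⟨⟨h1, h2⟩, h3⟩ := h
  rw [Set.mem_singleton_iff] at h3
  omega

/-- The quadrature is exact on `𝒫_{T^k}`. -/
lemma meanLM_eq_quadLM_of_mem (hn : 3 ≤ n) {m : ℕ} {f : ℝ[X]}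
    (hf : f ∈ polySpace n (indexSet (m + 1))) : meanLM hn f = quadLM n m f := by
  rw [polySpace] at hf
  induction hf using Submodule.span_induction with
  | mem f hf =>
    obtain ⟨i, hi, rfl⟩ := hf
    have hlt : i < 2 * m + 2 → meanLM hn (gegenbauer n i) = quadLM n m (gegenbauer n i) :=
      fun h => (quadLM_eq_meanLM hn
        (mem_degreeLT_mono (by omega) (gegenbauer_mem_degreeLT hn i))).symm
    rcases hi with hi | hi
    · obtain ⟨_, h | rfl | rfl⟩ := mem_indexSet_succ hi
      · exact hlt h
      · rw [quadLM_gegenbauer_odd hn, meanLM_gegenbauer hn]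
      · rw [quadLM_gegenbauer_even hn, meanLM_gegenbauer hn]
    · rw [Set.mem_singleton_iff] at hi
      exact hlt (by omega)
  | zero => simp
  | add f g _ _ hf hg => rw [map_add, map_add, hf, hg]
  | smul r f _ hf => rw [map_smul, map_smul, hf]

/-! ### Polynomials with nonnegative Taylor coefficients at `-1` -/

/-- The Taylor coefficients of `f` at `-1` are nonnegative. -/
def NonnegTaylor (f : ℝ[X]) : Prop := ∀ i, 0 ≤ (taylor (-1) f).coeff i

lemma NonnegTaylor.eval_nonneg {f : ℝ[X]} (hf : NonnegTaylor f) {t : ℝ} (ht : -1 ≤ t) :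
    0 ≤ f.eval t := by
  have : f.eval t = (taylor (-1) f).eval (t + 1) := by rw [taylor_eval]; simp
  rw [this, eval_eq_sum_range]
  exact Finset.sum_nonneg fun i _ => mul_nonneg (hf i) (pow_nonneg (by linarith) i)

lemma NonnegTaylor.eval_pos {f : ℝ[X]} (hf : NonnegTaylor f) (h0 : f ≠ 0) {t : ℝ}
    (ht : -1 < t) : 0 < f.eval t := by
  have : f.eval t = (taylor (-1) f).eval (t + 1) := by rw [taylor_eval]; simp
  have ht1 : 0 < t + 1 := by linarith
  have hT : taylor (-1) f ≠ 0 := by rwa [Ne, taylor_eq_zero]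
  rw [this, eval_eq_sum_range]
  refine Finset.sum_pos' (fun i _ => mul_nonneg (hf i) (pow_nonneg ht1.le i))
    ⟨_, Finset.self_mem_range_succ _, mul_pos ((hf _).lt_of_ne' ?_) (pow_pos ht1 _)⟩
  rwa [coeff_natDegree, leadingCoeff_ne_zero]

lemma nonnegTaylor_X_add_one_pow (j : ℕ) : NonnegTaylor ((X + 1) ^ j) := by
  intro i
  have : taylor (-1) ((X + 1 : ℝ[X]) ^ j) = X ^ j := by
    rw [taylor_pow, map_add, taylor_X, taylor_one]
    simp
  rw [this, coeff_X_pow]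
  split_ifs <;> norm_num

/-- Synthetic division in the variable t + 1: the coefficients of the quotient are sums of those of
f times powers of β + 1 ≥ 0. -/
lemma NonnegTaylor.exists_eq_add_mul {f : ℝ[X]} (hf : NonnegTaylor f) {β : ℝ} (hβ : -1 ≤ β) :
    ∃ g, f = C (f.eval β) + (X - C β) * g ∧ NonnegTaylor g := by
  set F := taylor (-1) f with hF
  set G := F /ₘ (X - C (β + 1)) with hG
  have hfF : f = taylor 1 F := by rw [hF, taylor_taylor]; simp
  refine ⟨taylor 1 G, ?_, fun i => ?_⟩
  · have h := modByMonic_add_div F (X - C (β + 1))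
    rw [modByMonic_X_sub_C_eq_C_eval] at h
    have h' := congrArg (taylor 1) h
    rw [map_add, taylor_mul, taylor_C, map_sub, taylor_X, taylor_C, ← hfF] at h'
    have : F.eval (β + 1) = f.eval β := by rw [hF, taylor_eval]; simp
    rw [this, ← hG, C_add] at h'
    linear_combination -h'
  · rw [taylor_taylor, neg_add_cancel, taylor_zero, hG, coeff_divByMonic_X_sub_C]
    exact Finset.sum_nonneg fun j _ => mul_nonneg (pow_nonneg (by linarith) _) (hf j)

/-- Newton interpolation with multiplicities, one division per point. -/
lemma NonnegTaylor.exists_eq_add_prod_mul {f : ℝ[X]} (hf : NonnegTaylor f) (s : Multiset ℝ)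
    (hs : ∀ β ∈ s, -1 ≤ β) :
    ∃ r g, f = r + (s.map fun β => X - C β).prod * g ∧ r ∈ degreeLT ℝ (Multiset.card s) ∧
      NonnegTaylor g := by
  induction s using Multiset.induction_on with
  | empty => exact ⟨0, f, by simp, zero_mem _, hf⟩
  | cons β s ih =>
    obtain ⟨r, g, hfr, hr, hg⟩ := ih fun γ hγ => hs γ (Multiset.mem_cons_of_mem hγ)
    obtain ⟨g', hgg', hg'⟩ := hg.exists_eq_add_mul (hs β (Multiset.mem_cons_self β s))
    refine ⟨r + (s.map fun β => X - C β).prod * C (g.eval β), g', ?_, ?_, hg'⟩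
    · rw [Multiset.map_cons, Multiset.prod_cons]
      conv_lhs => rw [hfr, hgg']
      ring
    · rw [Multiset.card_cons]
      refine add_mem (mem_degreeLT_mono (Nat.le_succ _) hr) ?_
      refine mul_mem_degreeLT (a := Multiset.card s + 1) (b := 1) ?_ (C_mem_degreeLT _ one_pos)
        (by omega)
      rw [mem_degreeLT_succ_iff, natDegree_multiset_prod_X_sub_C_eq_card]

/-! ### The defect of a design -/

/-- The difference between the potential of a polynomial at the point `x` and `N` times its
quadrature at the nodes. -/
def defectLM (m : ℕ) (C : Finset (EuclideanSpace ℝ (Fin n))) (x : EuclideanSpace ℝ (Fin n)) :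
    ℝ[X] →ₗ[ℝ] ℝ :=
  ∑ y ∈ C, leval (inner ℝ x y) - (C.card : ℝ) • quadLM n m

lemma defectLM_apply (m : ℕ) (C : Finset (EuclideanSpace ℝ (Fin n)))
    (x : EuclideanSpace ℝ (Fin n)) (f : ℝ[X]) :
    defectLM m C x f = ∑ y ∈ C, f.eval (inner ℝ x y) - C.card * quadLM n m f := by
  simp [defectLM, LinearMap.sum_apply]

section Design

variable {m : ℕ} {D : Finset (EuclideanSpace ℝ (Fin n))} {x : EuclideanSpace ℝ (Fin n)}

lemma inner_mem_Icc (hD : IsSphericalDesign (indexSet (m + 1)) D) (hx : ‖x‖ = 1)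
    {y : EuclideanSpace ℝ (Fin n)} (hy : y ∈ D) : inner ℝ x y ∈ Set.Icc (-1 : ℝ) 1 := by
  have := abs_real_inner_le_norm x y
  rw [hx, hD.1.2 y hy, one_mul] at this
  exact abs_le.1 this

variable (hn : 3 ≤ n) (hD : IsSphericalDesign (indexSet (m + 1)) D) (hx : ‖x‖ = 1)

include hn hD hx

lemma sum_gegenbauer_eq_zero {i : ℕ} (hi : i ∈ indexSet (m + 1)) :
    ∑ y ∈ D, (gegenbauer n i).eval (inner ℝ x y) = 0 :=
  sum_gegenbauer_eq_zero_of_moment_eq_zero hn hD.1.2 (hD.2 i hi) hx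

lemma defectLM_gegenbauer_odd : defectLM m D x (gegenbauer n (2 * m + 3)) = 0 := by
  rw [defectLM_apply, quadLM_gegenbauer_odd hn, sum_gegenbauer_eq_zero hn hD hx]
  · ring
  · exact ⟨⟨by omega, by omega⟩, by rw [Set.mem_singleton_iff]; omega⟩

lemma defectLM_gegenbauer_even : defectLM m D x (gegenbauer n (2 * m + 4)) = 0 := by
  rw [defectLM_apply, quadLM_gegenbauer_even hn, sum_gegenbauer_eq_zero hn hD hx]
  · ring
  · exact ⟨⟨by omega, by omega⟩, by rw [Set.mem_singleton_iff]; omega⟩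

lemma defectLM_eq_zero_of_mem {f : ℝ[X]} (hf : f ∈ degreeLT ℝ (2 * m + 2)) :
    defectLM m D x f = 0 := by
  refine eq_zero_of_mem_degreeLT hn _ (fun i hi => ?_) hf
  rw [defectLM_apply, quadLM_eq_meanLM hn
    (mem_degreeLT_mono (by omega) (gegenbauer_mem_degreeLT hn i))]
  rcases i with _ | i
  · simp [gegenbauer_zero, meanLM_one]
  · rw [meanLM_gegenbauer hn, sum_gegenbauer_eq_zero hn hD hx]
    · ring
    · exact ⟨⟨by omega, by omega⟩, by rw [Set.mem_singleton_iff]; omega⟩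

lemma defectLM_congr {f g : ℝ[X]} (h : f - g ∈ degreeLT ℝ (2 * m + 2)) :
    defectLM m D x f = defectLM m D x g := by
  have := defectLM_eq_zero_of_mem hn hD hx h
  rwa [map_sub, sub_eq_zero] at this

lemma defectLM_X_pow_odd : defectLM m D x (X ^ (2 * m + 3)) = 0 := by
  have h := defectLM_congr hn hD hx (mem_degreeLT_mono (by omega)
    (gegenbauer_sub_lead_mem hn (2 * m + 3)))
  rw [defectLM_gegenbauer_odd hn hD hx, map_C_mul] at h
  exact (mul_eq_zero.1 h.symm).resolve_left (gegLead_pos hn _).ne'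

/-- In q² = q r + (b - c) q P_m the first term has zero defect, and the second reduces to its
leading term t^{2m+2}. -/
lemma defectLM_nodePoly_sq : defectLM m D x (nodePoly n (m + 1) ^ 2) =
    (bCoeff n (m + 1) - cCoeff n (m + 1)) * (gegLead n (m + 2) * gegLead n m) *
      defectLM m D x (X ^ (2 * m + 2)) := by
  have e : nodePoly n (m + 1) ^ 2 = nodePoly n (m + 1) * conjPoly n (m + 1) +
      C (bCoeff n (m + 1) - cCoeff n (m + 1)) * (nodePoly n (m + 1) * gegenbauer n m) := by
    rw [conjPoly_succ, nodePoly_succ, C_sub]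
    ring
  have h1 := defectLM_congr hn hD hx (nodePoly_mul_conjPoly_mem hn m)
  have h2 := defectLM_congr hn hD hx (mem_degreeLT_mono (by omega)
    (nodePoly_mul_gegenbauer_mem hn m m))
  rw [map_C_mul, defectLM_gegenbauer_even hn hD hx, mul_zero] at h1
  rw [map_C_mul, (by ring : m + 2 + m = 2 * m + 2)] at h2
  rw [e, map_add, map_C_mul, h1, h2]
  ring

omit hD hx in
lemma defectLM_nodePoly_sq_mul (g : ℝ[X]) : defectLM m D x (nodePoly n (m + 1) ^ 2 * g) =
    ∑ y ∈ D, (nodePoly n (m + 1)).eval (inner ℝ x y) ^ 2 * g.eval (inner ℝ x y) := by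
  rw [defectLM_apply, sq, mul_assoc, quadLM_nodePoly_mul hn]
  simp only [eval_mul]
  rw [mul_zero, sub_zero]
  exact Finset.sum_congr rfl fun _ _ => by ring

omit hD hx in
lemma defectLM_nodePoly_sq_eq_sum : defectLM m D x (nodePoly n (m + 1) ^ 2) =
    ∑ y ∈ D, (nodePoly n (m + 1)).eval (inner ℝ x y) ^ 2 := by
  simpa using defectLM_nodePoly_sq_mul (D := D) (x := x) hn (m := m) 1

omit hD hx in
lemma bCoeff_sub_cCoeff_mul_pos :
    0 < (bCoeff n (m + 1) - cCoeff n (m + 1)) * (gegLead n (m + 2) * gegLead n m) :=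
  mul_pos (sub_pos.2 (cCoeff_lt_bCoeff hn m)) (mul_pos (gegLead_pos hn _) (gegLead_pos hn _))

lemma defectLM_X_pow_nonneg : 0 ≤ defectLM m D x (X ^ (2 * m + 2)) := by
  have h := defectLM_nodePoly_sq hn hD hx
  rw [defectLM_nodePoly_sq_eq_sum hn] at h
  refine (mul_nonneg_iff_of_pos_left (bCoeff_sub_cCoeff_mul_pos hn (m := m))).1 ?_
  rw [← h]
  exact Finset.sum_nonneg fun _ _ => sq_nonneg _

lemma inner_mem_nodes_of_defectLM_eq_zero (h : defectLM m D x (X ^ (2 * m + 2)) = 0) :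
    ∀ y ∈ D, inner ℝ x y ∈ nodes n (m + 1) := by
  have h1 := defectLM_nodePoly_sq hn hD hx
  rw [defectLM_nodePoly_sq_eq_sum hn, h, mul_zero,
    Finset.sum_eq_zero_iff_of_nonneg fun _ _ => sq_nonneg _] at h1
  intro y hy
  rw [mem_nodes_iff hn]
  exact pow_eq_zero_iff two_ne_zero |>.1 (h1 y hy)

omit hD hx in
/-- Splitting off a positive node from the node polynomial. -/
lemma exists_nodePoly_factor : ∃ r ∈ nodes n (m + 1), 0 < r ∧ ∃ s : Multiset ℝ,
    Multiset.card s = m + 1 ∧ (∀ β ∈ s, -1 ≤ β) ∧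
    nodePoly n (m + 1) =
      C (gegLead n (m + 2)) * ((X - C r) * (s.map fun β => X - C β).prod) := by
  obtain ⟨r, hr, hr0⟩ := exists_pos_node hn m
  have hr' : r ∈ (nodePoly n (m + 1)).roots := Multiset.mem_toFinset.1 hr
  have hcard := card_roots_nodePoly hn m
  refine ⟨r, hr, hr0, (nodePoly n (m + 1)).roots.erase r, ?_, fun β hβ => ?_, ?_⟩
  · rw [Multiset.card_erase_of_mem hr', hcard]
    rfl
  · exact (nodes_subset hn m (Multiset.mem_toFinset.2 (Multiset.mem_of_mem_erase hβ))).1.le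
  · have h1 := C_leadingCoeff_mul_prod_multiset_X_sub_C
      (p := nodePoly n (m + 1)) (by rw [hcard, natDegree_nodePoly hn])
    rw [leadingCoeff, natDegree_nodePoly hn, coeff_nodePoly hn] at h1
    rw [← Multiset.prod_cons, ← Multiset.map_cons (fun β => X - C β), Multiset.cons_erase hr', h1]

/-- With β a positive node and p the monic product over the others, Newton's form reads (1 + t)^j =
(degree ≤ 2m + 1) + g(β) p² + g₁(β) (t - β) p² + ((t - β) p)² g₂. The defects of the last three
terms are g(β) ε, g₁(β) β ε and a nonnegative sum. Positivity of β is what gives the middle one its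
sign. -/
lemma exists_mul_le_defectLM (j : ℕ) : ∃ κ : ℝ, 0 ≤ κ ∧ (2 * m + 2 ≤ j → 0 < κ) ∧
    κ * defectLM m D x (X ^ (2 * m + 2)) ≤ defectLM m D x ((X + 1) ^ j) := by
  obtain ⟨β, hβ, hβ0, s, hs, hs1, hq⟩ := exists_nodePoly_factor (m := m) hn
  set p := (s.map fun β => X - C β).prod with hp
  have hl := gegLead_pos hn (m + 2)
  have hpmem : p ∈ degreeLT ℝ (m + 2) := by
    rw [mem_degreeLT_succ_iff, hp, natDegree_multiset_prod_X_sub_C_eq_card, hs]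
  have hpm : p.coeff (m + 1) = 1 := by
    have h1 : p.Monic := monic_multiset_prod_of_monic _ _ fun a _ => monic_X_sub_C a
    have h2 : p.natDegree = m + 1 := by
      rw [hp, natDegree_multiset_prod_X_sub_C_eq_card, hs]
    rw [← h2]
    exact h1
  have hq' : (X - C β) * p - X ^ (m + 2) ∈ degreeLT ℝ (m + 1) := by
    apply mem_degreeLT_of_C_mul_mem hl.ne'
    rw [mul_sub, ← hq]
    exact nodePoly_sub_lead_mem hn m
  -- The polynomial q has no t^{m+1} term, so the other nodes sum to -β.
  have hpc : p.coeff m = β := by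
    have h1 := coeff_eq_zero_of_mem hq' le_rfl
    rw [sub_mul, coeff_sub, coeff_sub, coeff_X_mul, coeff_C_mul, hpm, coeff_X_pow,
      if_neg (by omega)] at h1
    linarith
  have hp2 : p - X ^ (m + 1) - C β * X ^ m ∈ degreeLT ℝ m := by
    rw [mem_degreeLT, degree_lt_iff_coeff_zero]
    intro i hi
    rw [coeff_sub, coeff_sub, coeff_C_mul, coeff_X_pow, coeff_X_pow]
    rcases hi.eq_or_lt with rfl | hi
    · rw [hpc, if_neg (by omega), if_pos rfl]
      ring
    · rcases (Nat.succ_le_of_lt hi).eq_or_lt with rfl | hi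
      · rw [Nat.succ_eq_add_one, hpm, if_pos rfl, if_neg (by omega)]
        ring
      · rw [coeff_eq_zero_of_mem hpmem hi, if_neg (by omega), if_neg (by omega)]
        ring
  have hp1 : p - X ^ (m + 1) ∈ degreeLT ℝ (m + 1) := by
    have := add_mem (mem_degreeLT_mono (Nat.le_succ m) hp2)
      (C_mul_mem_degreeLT β (X_pow_mem_degreeLT (Nat.lt_succ_self m)))
    simpa using this
  have hXm : (X ^ (m + 1) : ℝ[X]) ∈ degreeLT ℝ (m + 2) := X_pow_mem_degreeLT (by omega)
  have hXm2 : (X ^ (m + 2) : ℝ[X]) ∈ degreeLT ℝ (m + 3) := X_pow_mem_degreeLT (by omega)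
  have f0 : defectLM m D x (p ^ 2) = defectLM m D x (X ^ (2 * m + 2)) := by
    refine defectLM_congr hn hD hx ?_
    have e : p ^ 2 - X ^ (2 * m + 2) = (p - X ^ (m + 1)) * (p + X ^ (m + 1)) := by ring
    rw [e]
    exact mul_mem_degreeLT hp1 (add_mem hpmem hXm) (by omega)
  have f1 : defectLM m D x (p * ((X - C β) * p)) = β * defectLM m D x (X ^ (2 * m + 2)) := by
    have h : defectLM m D x (p * ((X - C β) * p)) =
        defectLM m D x (X ^ (2 * m + 3) + C β * X ^ (2 * m + 2)) := by
      refine defectLM_congr hn hD hx ?_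
      have e : p * ((X - C β) * p) - (X ^ (2 * m + 3) + C β * X ^ (2 * m + 2)) =
          p * ((X - C β) * p - X ^ (m + 2)) +
            (p - X ^ (m + 1) - C β * X ^ m) * X ^ (m + 2) := by ring
      rw [e]
      exact add_mem (mul_mem_degreeLT hpmem hq' (by omega))
        (mul_mem_degreeLT hp2 hXm2 (by omega))
    rw [h, map_add, map_C_mul, defectLM_X_pow_odd hn hD hx, zero_add]
  have hfj := nonnegTaylor_X_add_one_pow j
  -- The other nodes are used twice first and β twice last, so that p² already divides every term
  -- beyond degree 2m + 1.
  obtain ⟨r, g, hfr, hr, hg⟩ := hfj.exists_eq_add_prod_mul (s + s) (by simpa using hs1)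
  rw [Multiset.map_add, Multiset.prod_add, ← hp] at hfr
  rw [Multiset.card_add, hs] at hr
  have hβ1 : -1 ≤ β := by linarith
  obtain ⟨g₁, hgg₁, hg₁⟩ := hg.exists_eq_add_mul hβ1
  obtain ⟨g₂, hgg₂, hg₂⟩ := hg₁.exists_eq_add_mul hβ1
  have f2 : 0 ≤ defectLM m D x (((X - C β) * p) ^ 2 * g₂) := by
    have h1 : 0 ≤ defectLM m D x (nodePoly n (m + 1) ^ 2 * g₂) := by
      rw [defectLM_nodePoly_sq_mul hn]
      exact Finset.sum_nonneg fun y hy => mul_nonneg (sq_nonneg _)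
        (hg₂.eval_nonneg (inner_mem_Icc hD hx hy).1)
    rw [hq, mul_pow, ← C_pow, mul_assoc, map_C_mul] at h1
    exact (mul_nonneg_iff_of_pos_left (pow_pos hl 2)).1 h1
  have hF : defectLM m D x ((X + 1) ^ j) =
      g.eval β * defectLM m D x (X ^ (2 * m + 2)) +
      g₁.eval β * (β * defectLM m D x (X ^ (2 * m + 2))) +
      defectLM m D x (((X - C β) * p) ^ 2 * g₂) := by
    have e : (X + 1 : ℝ[X]) ^ j = r + (C (g.eval β) * p ^ 2 +
        C (g₁.eval β) * (p * ((X - C β) * p)) + ((X - C β) * p) ^ 2 * g₂) := by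
      rw [hfr]
      conv_lhs => rw [hgg₁, hgg₂]
      ring
    rw [e, map_add, defectLM_eq_zero_of_mem hn hD hx (mem_degreeLT_mono (by omega) hr), zero_add,
      map_add, map_add, map_C_mul, map_C_mul, f0, f1]
  refine ⟨g.eval β, hg.eval_nonneg hβ1, fun hj => hg.eval_pos ?_ (by linarith), ?_⟩
  -- If g were zero, (1 + t)^j would equal r, of degree ≤ 2m + 1 < j.
  · rintro rfl
    rw [mul_zero, add_zero] at hfr
    rw [← hfr, show m + 1 + (m + 1) = 2 * m + 1 + 1 by ring, mem_degreeLT_succ_iff,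
      natDegree_pow, ← C_1, natDegree_X_add_C] at hr
    omega
  · rw [hF]
    have := mul_nonneg (hg₁.eval_nonneg hβ1)
      (mul_nonneg hβ0.le (defectLM_X_pow_nonneg hn hD hx))
    linarith

lemma defectLM_X_add_one_pow_nonneg (j : ℕ) : 0 ≤ defectLM m D x ((X + 1) ^ j) := by
  obtain ⟨κ, h0, -, h⟩ := exists_mul_le_defectLM hn hD hx j
  exact (mul_nonneg h0 (defectLM_X_pow_nonneg hn hD hx)).trans h

/-- The Lagrange basis polynomial of a node counts the points with that inner product, and its
defect is zero. Positive weights make every node occur. -/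
lemma hasNodeDistribution_of_inner_mem (h : ∀ y ∈ D, inner ℝ x y ∈ nodes n (m + 1)) :
    HasNodeDistribution (m + 1) D x := by
  have hcount : ∀ β ∈ nodes n (m + 1), ((D.filter fun y => (inner ℝ x y : ℝ) = β).card : ℝ) =
      D.card * nodeWeight n (m + 1) β := by
    intro β hβ
    have hB := mem_degreeLT_mono (b := 2 * m + 2) (by omega) (basis_mem_degreeLT hn m hβ)
    have h1 := defectLM_eq_zero_of_mem hn hD hx hB
    rw [defectLM_apply, quadLM_eq_meanLM hn hB, ← nodeWeight_eq, sub_eq_zero] at h1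
    rw [← h1, Finset.card_filter, Nat.cast_sum]
    refine Finset.sum_congr rfl fun y hy => ?_
    split_ifs with hyβ
    · rw [hyβ]
      exact_mod_cast (Lagrange.eval_basis_self (v := id) Function.injective_id.injOn hβ).symm
    · exact_mod_cast (Lagrange.eval_basis_of_ne (v := id) (Ne.symm hyβ) (h y hy)).symm
  refine ⟨Finset.Subset.antisymm (Finset.image_subset_iff.2 h) fun β hβ => ?_, hcount⟩
  have hpos : (0 : ℝ) < (D.filter fun y => (inner ℝ x y : ℝ) = β).card := by
    rw [hcount β hβ]
    exact mul_pos (by exact_mod_cast hD.1.1.card_pos) (nodeWeight_pos hn m hβ)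
  obtain ⟨y, hy⟩ := Finset.card_pos.1 (by exact_mod_cast hpos)
  rw [Finset.mem_filter] at hy
  exact Finset.mem_image.2 ⟨y, hy.1, hy.2⟩

lemma hasNodeDistribution_of_defectLM_eq_zero {j : ℕ} (hj : 2 * m + 2 ≤ j)
    (h : defectLM m D x ((X + 1) ^ j) = 0) : HasNodeDistribution (m + 1) D x := by
  obtain ⟨κ, -, h1, h2⟩ := exists_mul_le_defectLM hn hD hx j
  refine hasNodeDistribution_of_inner_mem hn hD hx
    (inner_mem_nodes_of_defectLM_eq_zero hn hD hx ?_)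
  refine le_antisymm ?_ (defectLM_X_pow_nonneg hn hD hx)
  rw [h] at h2
  exact nonpos_of_mul_nonpos_right h2 (h1 hj)

end Design

variable {m : ℕ}

/-! ### Absolutely monotone potentials -/

open Filter Topology Set in
/-- An absolutely monotone potential dominates a power series with nonnegative coefficients and
agrees with it on `[-1, 1)`. -/
lemma IsAbsMonotonePotential.exists_series {h : ℝ → ℝ≥0∞} (hh : IsAbsMonotonePotential h) :
    ∃ a : ℕ → ℝ, (∀ j, 0 ≤ a j) ∧
      (∀ t ∈ Ico (-1 : ℝ) 1, HasSum (fun j => a j * (1 + t) ^ j) (h t).toReal) ∧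
      (∀ t ∈ Ico (-1 : ℝ) 1, h t = ∑' j, ENNReal.ofReal (a j * (1 + t) ^ j)) ∧
      ∀ t ∈ Icc (-1 : ℝ) 1, ∑' j, ENNReal.ofReal (a j * (1 + t) ^ j) ≤ h t := by
  have hc : ContinuousOn (fun t => (h t).toReal) (Ico (-1) 1) := fun t ht =>
    (ENNReal.tendsto_toReal (hh.finite t ht)).comp (hh.continuousOn t ht)
  obtain ⟨a, ha, hs⟩ := hasSum_of_absolutelyMonotoneOn hh.absMonotone hc
  have heq : ∀ t ∈ Ico (-1 : ℝ) 1, h t = ∑' j, ENNReal.ofReal (a j * (1 + t) ^ j) := by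
    intro t ht
    have h1 := hs t ht
    rw [← ENNReal.ofReal_tsum_of_nonneg
      (fun j => mul_nonneg (ha j) (pow_nonneg (by linarith [ht.1]) j)) h1.summable, h1.tsum_eq,
      ENNReal.ofReal_toReal (hh.finite t ht)]
  refine ⟨a, ha, hs, heq, fun t ht => ?_⟩
  rcases ht.2.eq_or_lt with rfl | h1
  -- At t = 1 each partial sum is the left limit of partial sums bounded by h(u) ≤ h(1).
  · rw [ENNReal.tsum_eq_iSup_sum]
    refine iSup_le fun s => ?_
    have hcont : Continuous fun t : ℝ => ∑ j ∈ s, ENNReal.ofReal (a j * (1 + t) ^ j) :=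
      continuous_finsetSum _ fun j _ => ENNReal.continuous_ofReal.comp (by fun_prop)
    refine le_of_tendsto (hcont.continuousAt.tendsto.mono_left (nhdsWithin_le_nhds (s := Iio 1))) ?_
    filter_upwards [Ioo_mem_nhdsLT (by norm_num : (-1 : ℝ) < 1)] with u hu
    refine le_trans ?_ (hh.le_one u (Ioo_subset_Ico_self hu))
    rw [heq u (Ioo_subset_Ico_self hu)]
    exact ENNReal.sum_le_tsum s
  · exact (heq t ⟨ht.1, h1⟩).ge

lemma exists_coeff_ne_zero {h : ℝ → ℝ≥0∞} {a : ℕ → ℝ} {d : ℕ}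
    (hs : ∀ t ∈ Set.Ico (-1 : ℝ) 1, HasSum (fun j => a j * (1 + t) ^ j) (h t).toReal)
    (hp : ¬ IsPolynomialOfDegreeLT d h) : ∃ j, d ≤ j ∧ a j ≠ 0 := by
  by_contra! h0
  refine hp ⟨∑ j ∈ Finset.range d, C (a j) * (1 + X) ^ j, ?_, fun t ht => ?_⟩
  · rw [← mem_degreeLT]
    refine Submodule.sum_mem _ fun j hj => C_mul_mem_degreeLT _ ?_
    refine mem_degreeLT_mono (Nat.succ_le_of_lt (Finset.mem_range.1 hj)) ?_
    rw [Nat.succ_eq_add_one, mem_degreeLT_succ_iff, natDegree_pow, add_comm, ← C_1,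
      natDegree_X_add_C, mul_one]
  · have h1 : HasSum (fun j => a j * (1 + t) ^ j) (∑ j ∈ Finset.range d, a j * (1 + t) ^ j) :=
      hasSum_sum_of_ne_finset_zero fun j hj => by
        rw [h0 j (by simpa using hj), zero_mul]
    rw [(hs t ht).unique h1, eval_finsetSum]
    simp

section Bound

variable {D : Finset (EuclideanSpace ℝ (Fin n))} {x : EuclideanSpace ℝ (Fin n)}
  {h : ℝ → ℝ≥0∞} {a : ℕ → ℝ}

/-- Termwise summation in [0, ∞]; nonnegativity of each defect allows the split inside
`ENNReal.ofReal`. -/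
lemma potential_eq_bound_add (hn : 3 ≤ n) (hD : IsSphericalDesign (indexSet (m + 1)) D)
    (hx : ‖x‖ = 1) (ha : ∀ j, 0 ≤ a j) :
    ∑ y ∈ D, ∑' j, ENNReal.ofReal (a j * (1 + inner ℝ x y) ^ j) =
      D.card * ∑ β ∈ nodes n (m + 1), ENNReal.ofReal (nodeWeight n (m + 1) β) *
        ∑' j, ENNReal.ofReal (a j * (1 + β) ^ j) +
      ∑' j, ENNReal.ofReal (a j * defectLM m D x ((X + 1) ^ j)) := by
  have hb : ∀ β ∈ nodes n (m + 1), 0 ≤ 1 + β := fun β hβ => by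
    linarith [(nodes_subset hn m hβ).1]
  have hy : ∀ y ∈ D, 0 ≤ 1 + inner ℝ x y := fun y hy => by
    linarith [(inner_mem_Icc hD hx hy).1]
  have e1 : ∀ β ∈ nodes n (m + 1), ENNReal.ofReal (nodeWeight n (m + 1) β) *
      ∑' j, ENNReal.ofReal (a j * (1 + β) ^ j) =
      ∑' j, ENNReal.ofReal (nodeWeight n (m + 1) β * (a j * (1 + β) ^ j)) := by
    intro β hβ
    rw [← ENNReal.tsum_mul_left]
    exact tsum_congr fun j => (ENNReal.ofReal_mul (nodeWeight_pos hn m hβ).le).symm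
  rw [Finset.sum_congr rfl e1, ← Summable.tsum_finsetSum fun _ _ => ENNReal.summable,
    ← Summable.tsum_finsetSum fun _ _ => ENNReal.summable, ← ENNReal.tsum_mul_left,
    ← ENNReal.tsum_add]
  refine tsum_congr fun j => ?_
  have hq : ∀ β ∈ nodes n (m + 1), 0 ≤ nodeWeight n (m + 1) β * (a j * (1 + β) ^ j) :=
    fun β hβ => mul_nonneg (nodeWeight_pos hn m hβ).le
      (mul_nonneg (ha j) (pow_nonneg (hb β hβ) j))
  rw [← ENNReal.ofReal_sum_of_nonneg fun y hyD => mul_nonneg (ha j) (pow_nonneg (hy y hyD) j),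
    ← ENNReal.ofReal_sum_of_nonneg hq, ← ENNReal.ofReal_natCast,
    ← ENNReal.ofReal_mul (Nat.cast_nonneg _),
    ← ENNReal.ofReal_add (mul_nonneg (Nat.cast_nonneg _) (Finset.sum_nonneg hq))
      (mul_nonneg (ha j) (defectLM_X_add_one_pow_nonneg hn hD hx j))]
  congr 1
  rw [defectLM_apply, quadLM_apply, ← Finset.mul_sum]
  have e2 : ∑ β ∈ nodes n (m + 1), nodeWeight n (m + 1) β * (a j * (1 + β) ^ j) =
      a j * ∑ β ∈ nodes n (m + 1), nodeWeight n (m + 1) β * ((X + 1 : ℝ[X]) ^ j).eval β := by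
    rw [Finset.mul_sum]
    refine Finset.sum_congr rfl fun β _ => ?_
    rw [eval_pow, eval_add, eval_X, eval_one]
    ring
  rw [e2]
  simp only [eval_pow, eval_add, eval_X, eval_one, add_comm (1 : ℝ)]
  ring

/-- The potential exceeds the bound at least by the defect of each term of the power series. -/
lemma bound_add_defect_le (hn : 3 ≤ n) (hD : IsSphericalDesign (indexSet (m + 1)) D)
    (hx : ‖x‖ = 1) (ha : ∀ j, 0 ≤ a j)
    (heq : ∀ t ∈ Set.Ico (-1 : ℝ) 1, h t = ∑' j, ENNReal.ofReal (a j * (1 + t) ^ j))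
    (hle : ∀ t ∈ Set.Icc (-1 : ℝ) 1, ∑' j, ENNReal.ofReal (a j * (1 + t) ^ j) ≤ h t) (j : ℕ) :
    secondLevelBound n (m + 1) D.card h + ENNReal.ofReal (a j * defectLM m D x ((X + 1) ^ j)) ≤
      potential h D x := by
  have h1 := Finset.sum_le_sum fun y hy => hle _ (inner_mem_Icc hD hx hy)
  rw [potential_eq_bound_add hn hD hx ha] at h1
  refine le_trans ?_ h1
  rw [secondLevelBound, Finset.sum_congr rfl fun β hβ => by
    rw [heq β (Set.Ioo_subset_Ico_self (nodes_subset hn m hβ))]]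
  exact add_le_add le_rfl (ENNReal.le_tsum j)

lemma secondLevelBound_ne_top (hn : 3 ≤ n) (hh : IsAbsMonotonePotential h) (N : ℕ) :
    secondLevelBound n (m + 1) N h ≠ ∞ :=
  ENNReal.mul_ne_top (ENNReal.natCast_ne_top N) (ENNReal.sum_ne_top.2 fun β hβ =>
    ENNReal.mul_ne_top ENNReal.ofReal_ne_top
      (hh.finite β (Set.Ioo_subset_Ico_self (nodes_subset hn m hβ))))

lemma secondLevelBound_le_potential (hn : 3 ≤ n) (hD : IsSphericalDesign (indexSet (m + 1)) D)
    (hx : ‖x‖ = 1) (hh : IsAbsMonotonePotential h) :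
    secondLevelBound n (m + 1) D.card h ≤ potential h D x := by
  obtain ⟨a, ha, -, heq, hle⟩ := hh.exists_series
  exact le_self_add.trans (bound_add_defect_le hn hD hx ha heq hle 0)

lemma secondLevelBound_le_polarization (hn : 3 ≤ n)
    (hD : IsSphericalDesign (indexSet (m + 1)) D) (hh : IsAbsMonotonePotential h) :
    secondLevelBound n (m + 1) D.card h ≤ polarization h D :=
  le_iInf fun x => secondLevelBound_le_potential hn hD (mem_sphere_zero_iff_norm.1 x.2) hh

lemma polarization_le_potential (hx : ‖x‖ = 1) : polarization h D ≤ potential h D x :=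
  iInf_le (fun x : Metric.sphere (0 : EuclideanSpace ℝ (Fin n)) 1 => potential h D x)
    ⟨x, mem_sphere_zero_iff_norm.2 hx⟩

lemma HasNodeDistribution.potential_eq (hD : HasNodeDistribution (m + 1) D x) (h : ℝ → ℝ≥0∞) :
    potential h D x = secondLevelBound n (m + 1) D.card h := by
  rw [potential, Finset.sum_comp h fun y => (inner ℝ x y : ℝ), hD.1, secondLevelBound,
    Finset.mul_sum]
  refine Finset.sum_congr rfl fun β hβ => ?_
  rw [nsmul_eq_mul, ← mul_assoc, ← ENNReal.ofReal_natCast, ← ENNReal.ofReal_natCast,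
    ← ENNReal.ofReal_mul (Nat.cast_nonneg _), hD.2 β hβ]

/-- A point at which the potential attains the bound has the node distribution. -/
lemma hasNodeDistribution_of_potential_eq (hn : 3 ≤ n)
    (hD : IsSphericalDesign (indexSet (m + 1)) D) (hx : ‖x‖ = 1)
    (hh : IsAbsMonotonePotential h) (hp : ¬ IsPolynomialOfDegreeLT (2 * (m + 1)) h)
    (he : potential h D x = secondLevelBound n (m + 1) D.card h) :
    HasNodeDistribution (m + 1) D x := by
  obtain ⟨a, ha, hs, heq, hle⟩ := hh.exists_series
  obtain ⟨j, hj, haj⟩ := exists_coeff_ne_zero hs hp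
  have h1 := bound_add_defect_le hn hD hx ha heq hle j
  rw [he] at h1
  -- The bound is finite because the nodes avoid 1, so nothing positive can be added to it.
  have h2 : ENNReal.ofReal (a j * defectLM m D x ((X + 1) ^ j)) = 0 := by
    by_contra hne
    exact absurd h1 (not_le.2 (ENNReal.lt_add_right (secondLevelBound_ne_top hn hh _) hne))
  have h3 := defectLM_X_add_one_pow_nonneg hn hD hx j
  rw [ENNReal.ofReal_eq_zero] at h2
  refine hasNodeDistribution_of_defectLM_eq_zero hn hD hx (by omega : 2 * m + 2 ≤ j)
    (le_antisymm ?_ h3)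
  exact nonpos_of_mul_nonpos_right h2 ((ha j).lt_of_ne' haj)

/-- Only the infimum is known to equal the bound, and h need not be continuous at 1. Compactness is
therefore applied to the defect of a single power, a continuous function of x, whose minimum must be
zero. -/
lemma exists_hasNodeDistribution (hn : 3 ≤ n)
    (hD : IsSphericalDesign (indexSet (m + 1)) D)
    (hh : IsAbsMonotonePotential h) (hp : ¬ IsPolynomialOfDegreeLT (2 * (m + 1)) h)
    (he : polarization h D = secondLevelBound n (m + 1) D.card h) :
    ∃ x : EuclideanSpace ℝ (Fin n), ‖x‖ = 1 ∧ HasNodeDistribution (m + 1) D x := by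
  obtain ⟨a, ha, hs, heq, hle⟩ := hh.exists_series
  obtain ⟨j, hj, haj⟩ := exists_coeff_ne_zero hs hp
  have hcont : Continuous fun x => defectLM m D x ((X + 1) ^ j) := by
    simp only [defectLM_apply]
    refine (continuous_finsetSum _ fun y _ => ?_).sub continuous_const
    exact (Polynomial.continuous _).comp (by fun_prop)
  obtain ⟨z, hz⟩ := hD.1.1
  obtain ⟨x₀, hx₀, hmin⟩ := (isCompact_sphere (0 : EuclideanSpace ℝ (Fin n)) 1).exists_isMinOn
    ⟨z, mem_sphere_zero_iff_norm.2 (hD.1.2 z hz)⟩ hcont.continuousOn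
  have hx₀' : ‖x₀‖ = 1 := mem_sphere_zero_iff_norm.1 hx₀
  refine ⟨x₀, hx₀', hasNodeDistribution_of_defectLM_eq_zero hn hD hx₀' (by omega : 2 * m + 2 ≤ j)
    (le_antisymm ?_ (defectLM_X_add_one_pow_nonneg hn hD hx₀' j))⟩
  have h1 : secondLevelBound n (m + 1) D.card h +
      ENNReal.ofReal (a j * defectLM m D x₀ ((X + 1) ^ j)) ≤ polarization h D := by
    refine le_iInf fun x => ?_
    refine le_trans ?_ (bound_add_defect_le hn hD (mem_sphere_zero_iff_norm.1 x.2) ha heq hle j)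
    exact add_le_add le_rfl (ENNReal.ofReal_le_ofReal
      (mul_le_mul_of_nonneg_left (hmin x.2) (ha j)))
  rw [he] at h1
  have h2 : ENNReal.ofReal (a j * defectLM m D x₀ ((X + 1) ^ j)) = 0 := by
    by_contra hne
    exact absurd h1 (not_le.2 (ENNReal.lt_add_right (secondLevelBound_ne_top hn hh _) hne))
  rw [ENNReal.ofReal_eq_zero] at h2
  exact nonpos_of_mul_nonpos_right h2 ((ha j).lt_of_ne' haj)

end Bound

end PULB

end

/-! ### The main theorem -/

theorem mainTheorem2 (n k : ℕ) (hn : 3 ≤ n) (hk : 1 ≤ k) :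
    -- the roots of `q_{k+1}` are nodes of a quadrature with positive weights exact on `𝒫_{T^k}`
    ((PULB.nodes n k).card = k + 1 ∧
      (∀ β ∈ PULB.nodes n k, β ∈ Set.Ioo (-1 : ℝ) 1 ∧ 0 < PULB.nodeWeight n k β) ∧
      ∀ f ∈ PULB.polySpace n (PULB.indexSet k),
        PULB.mean n (fun t => f.eval t) =
          ∑ β ∈ PULB.nodes n k, PULB.nodeWeight n k β * f.eval β) ∧
    ∀ C : Finset (EuclideanSpace ℝ (Fin n)),
      PULB.IsSphericalDesign (PULB.indexSet k) C →
      -- the bound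
      (∀ h, PULB.IsAbsMonotonePotential h →
        PULB.secondLevelBound n k C.card h ≤ PULB.polarization h C) ∧
      -- the characterization of equality
      (∀ h, PULB.IsAbsMonotonePotential h → ¬ PULB.IsPolynomialOfDegreeLT (2 * k) h →
        (PULB.polarization h C = PULB.secondLevelBound n k C.card h ↔
          ∃ x : EuclideanSpace ℝ (Fin n), ‖x‖ = 1 ∧ PULB.HasNodeDistribution k C x)) ∧
      -- a point with this distribution is a minimum for all potentials at once
      (∀ x : EuclideanSpace ℝ (Fin n), ‖x‖ = 1 → PULB.HasNodeDistribution k C x →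
        ∀ h, PULB.IsAbsMonotonePotential h →
          PULB.potential h C x = PULB.polarization h C ∧
          PULB.polarization h C = PULB.secondLevelBound n k C.card h) ∧
      -- in case of equality the minima are exactly these points, whatever the potential
      (∀ h, PULB.IsAbsMonotonePotential h → ¬ PULB.IsPolynomialOfDegreeLT (2 * k) h →
        PULB.polarization h C = PULB.secondLevelBound n k C.card h →
        ∀ x : EuclideanSpace ℝ (Fin n), ‖x‖ = 1 →
          (PULB.potential h C x = PULB.polarization h C ↔ PULB.HasNodeDistribution k C x)) := by
  -- Writing k = m + 1 removes the truncated subtraction in the index k - 1.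
  obtain ⟨m, rfl⟩ := Nat.exists_eq_add_of_le' hk
  refine ⟨⟨PULB.card_nodes hn m, fun β hβ => ⟨PULB.nodes_subset hn m hβ,
    PULB.nodeWeight_pos hn m hβ⟩, fun f hf => ?_⟩, fun D hD => ⟨fun h hh =>
    PULB.secondLevelBound_le_polarization hn hD hh, fun h hh hp => ⟨fun he =>
    PULB.exists_hasNodeDistribution hn hD hh hp he, ?_⟩, ?_, fun h hh hp he x hx =>
    ⟨fun hpx => PULB.hasNodeDistribution_of_potential_eq hn hD hx hh hp (hpx.trans he),
      fun hdx => (hdx.potential_eq h).trans he.symm⟩⟩⟩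
  · rw [← PULB.quadLM_apply]
    exact PULB.meanLM_eq_quadLM_of_mem hn hf
  · rintro ⟨x, hx, hdx⟩
    exact le_antisymm ((PULB.polarization_le_potential hx).trans (hdx.potential_eq h).le)
      (PULB.secondLevelBound_le_polarization hn hD hh)
  · intro x hx hdx h hh
    have h1 := hdx.potential_eq h
    have h2 : PULB.polarization h D = PULB.secondLevelBound n (m + 1) D.card h :=
      le_antisymm ((PULB.polarization_le_potential hx).trans h1.le)
        (PULB.secondLevelBound_le_polarization hn hD hh)
    exact ⟨h1.trans h2.symm, h2⟩
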